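/- Let $A\in\mathbb{R}^{3\times 3}$ and let $s_1\ge s_2\ge |s_3|$ be its proper singular values: if $s_1'\ge s_2'\ge s_3'\ge 0$ are the usual singular values of $A$ and $A=U'\,\mathrm{diag}(s_1',s_2',s_3')\,V'^{T}$ is a singular value decomposition, then $s_1=s_1'$, $s_2=s_2'$, $s_3=\det(U'V')\,s_3'$. Put $S=\mathrm{diag}(s_1,s_2,s_3)$ and let $$F(A)=\int_{\mathrm{SO}(3)}\frac{\exp\left(-\sqrt{\operatorname{tr}(S-A^{T}R)}\right)}{\sqrt{\operatorname{tr}(S-A^{T}R)}}\,dR$$ be the normalization factor of the rotation Laplace distribution with parameter $A$, where $dR$ is the Haar measure on $\mathrm{SO}(3)$ of total mass $1$. Set $$t_1=2(s_2+s_3),\qquad t_2=2(s_1+s_3),\qquad t_3=2(s_1+s_2),$$ and assume that $t_2>0$ (that is, $s_1=s_2=-s_3$ does not hold). Write $$\mathbf L_{\nu}(z)=\sum_{k\ge 0}\frac{(z/2)^{2k+\nu+1}}{\Gamma(k+\frac32)\,\Gamma(k+\nu+\frac32)},\qquad \mathbf I_{\nu}(z)=\sum_{k\ge 0}\frac{(z/2)^{2k+\nu}}{k!\,\Gamma(k+\nu+1)},\qquad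 \mathbf K(m)=\int_0^{\pi/2}\frac{d\theta}{\sqrt{1-m\sin^2\theta}}$$ for the modified Struve function, the modified Bessel function of the first kind, and the complete elliptic integral of the first kind as a function of the parameter $m$. Then the integral defining $F(A)$ converges absolutely. Moreover: (a) If $s_1,s_2,s_3$ are not all equal, then $$F(A)=\frac{2}{\pi}\left(\int_{t_1}^{t_2}\frac{\left(\mathbf L_{-1}(\sqrt k)-\mathbf I_{1}(\sqrt k)\right)\mathbf K\!\left(\frac{(k-t_1)(t_3-t_2)}{(t_1-t_2)(k-t_3)}\right)}{\sqrt{k(t_2-t_1)(t_3-k)}}\,dk+\int_{t_2}^{t_3}\frac{\left(\mathbf L_{-1}(\sqrt k)-\mathbf I_{1}(\sqrt k)\right)\mathbf K\!\left(\frac{(k-t_3)(t_1-t_2)}{(t_3-t_2)(k-t_1)}\right)}{\sqrt{k(t_2-t_3)(t_1-k)}}\,dk\right),$$ where both integrals converge absolutely, and an integral over a one-point interval is $0$. (b) If $s_1=s_2=s_3=s$, then $$F(A)=\frac{\mathbf L_{-1}(2\sqrt s)-\mathbf I_{1}(2\sqrt s)}{\sqrt s}.$$ -/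

import Mathlib

open MeasureTheory

namespace RotationLaplace

/-- The rotation group `SO(3)`, with the topology inherited from `ℝ^{3 × 3}`. -/
abbrev SO3 : Type := Matrix.specialOrthogonalGroup (Fin 3) ℝ

/-- `SO(3)` carries its Borel σ-algebra. -/
instance : MeasurableSpace SO3 := borel SO3

instance : BorelSpace SO3 := ⟨rfl⟩

instance : IsTopologicalGroup SO3 where
  continuous_mul := by
    refine Continuous.subtype_mk ?_ _
    exact (continuous_subtype_val.comp continuous_fst).mul
      (continuous_subtype_val.comp continuous_snd)
  continuous_inv := by
    refine Continuous.subtype_mk ?_ _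
    exact continuous_star.comp continuous_subtype_val

instance : CompactSpace SO3 := by
  suffices h : IsCompact
      (Matrix.specialOrthogonalGroup (Fin 3) ℝ : Set (Matrix (Fin 3) (Fin 3) ℝ)) from
    isCompact_iff_compactSpace.1 h
  have hsub : (Matrix.specialOrthogonalGroup (Fin 3) ℝ : Set (Matrix (Fin 3) (Fin 3) ℝ)) ⊆
      Set.pi Set.univ (fun _ => Set.pi Set.univ (fun _ => Set.Icc (-1 : ℝ) 1)) := by
    intro M hM i _ j _
    have h := entry_norm_bound_of_unitary (Matrix.mem_specialUnitaryGroup_iff.1 hM).1 i j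
    rw [Real.norm_eq_abs, abs_le] at h
    exact h
  refine IsCompact.of_isClosed_subset
    (isCompact_univ_pi fun _ => isCompact_univ_pi fun _ => isCompact_Icc) ?_ hsub
  have heq : (Matrix.specialOrthogonalGroup (Fin 3) ℝ : Set (Matrix (Fin 3) (Fin 3) ℝ)) =
      {M | M * star M = 1} ∩ {M | M.det = 1} := by
    ext M
    simp [Matrix.mem_specialUnitaryGroup_iff, Matrix.mem_unitaryGroup_iff]
  rw [heq]
  exact (isClosed_eq (continuous_id.mul continuous_star) continuous_const).inter
    (isClosed_eq (Continuous.matrix_det continuous_id) continuous_const)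

/-- The Haar measure `dR` on `SO(3)`, scaled so that `SO(3)` has mass one. -/
noncomputable def haarSO3 : Measure SO3 := Measure.haarMeasure ⊤

instance : IsProbabilityMeasure haarSO3 := ⟨Measure.haarMeasure_self⟩

/-- The usual singular values `s₁' ≥ s₂' ≥ s₃' ≥ 0` of a real `3 × 3` matrix. -/
noncomputable def singularValue (A : Matrix (Fin 3) (Fin 3) ℝ) (i : Fin 3) : ℝ :=
  (Matrix.toEuclideanLin A).singularValues i

/-- The proper singular values `(s₁, s₂, s₃) = (s₁', s₂', ± s₃')` of `A`. If `A = U' S' V'ᵀ` is a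
singular value decomposition, the sign of `s₃` is `det (U' V')`; this is the sign of `det A`
whenever `s₃' ≠ 0`, and it is irrelevant when `s₃' = 0`. -/
noncomputable def properSingularValue (A : Matrix (Fin 3) (Fin 3) ℝ) : Fin 3 → ℝ :=
  ![singularValue A 0, singularValue A 1, (SignType.sign A.det : ℝ) * singularValue A 2]

/-- The unnormalized density of the rotation Laplace distribution with parameter `A`, namely
`exp (-√(tr (S - Aᵀ R))) / √(tr (S - Aᵀ R))`, where `S` is the diagonal matrix of the proper
singular values of `A`. -/
noncomputable def unnormalizedDensity (A : Matrix (Fin 3) (Fin 3) ℝ) (R : SO3) : ℝ :=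
  Real.exp (-√(Matrix.trace
      (Matrix.diagonal (properSingularValue A) - A.transpose * (R : Matrix (Fin 3) (Fin 3) ℝ)))) /
    √(Matrix.trace
      (Matrix.diagonal (properSingularValue A) - A.transpose * (R : Matrix (Fin 3) (Fin 3) ℝ)))

/-- The normalization factor `F(A)` of the rotation Laplace distribution with parameter `A`. -/
noncomputable def normalizationFactor (A : Matrix (Fin 3) (Fin 3) ℝ) : ℝ :=
  ∫ R, unnormalizedDensity A R ∂haarSO3

/-- The modified Struve function
`L_ν(z) = ∑ₖ (z/2)^(2k+ν+1) / (Γ(k+3/2) Γ(k+ν+3/2))`, for `z > 0`. -/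
noncomputable def struveL (ν z : ℝ) : ℝ :=
  ∑' k : ℕ, (z / 2) ^ (2 * (k : ℝ) + ν + 1) /
    (Real.Gamma ((k : ℝ) + 3 / 2) * Real.Gamma ((k : ℝ) + ν + 3 / 2))

/-- The modified Bessel function of the first kind
`I_ν(z) = ∑ₖ (z/2)^(2k+ν) / (k! Γ(k+ν+1))`, for `z > 0`. -/
noncomputable def besselI (ν z : ℝ) : ℝ :=
  ∑' k : ℕ, (z / 2) ^ (2 * (k : ℝ) + ν) /
    ((Nat.factorial k : ℝ) * Real.Gamma ((k : ℝ) + ν + 1))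

/-- The complete elliptic integral of the first kind, as a function of the parameter `m < 1`:
`K(m) = ∫₀^{π/2} (1 - m sin² θ)^(-1/2) dθ`. -/
noncomputable def ellipticK (m : ℝ) : ℝ :=
  ∫ θ in (0 : ℝ)..(Real.pi / 2), 1 / √(1 - m * Real.sin θ ^ 2)

/-- The integrand of the normalization factor on `[t₁, t₂]`. -/
noncomputable def lowerIntegrand (t₁ t₂ t₃ k : ℝ) : ℝ :=
  (struveL (-1) √k - besselI 1 √k) *
      ellipticK (((k - t₁) * (t₃ - t₂)) / ((t₁ - t₂) * (k - t₃))) /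
    √(k * (t₂ - t₁) * (t₃ - k))

/-- The integrand of the normalization factor on `[t₂, t₃]`. -/
noncomputable def upperIntegrand (t₁ t₂ t₃ k : ℝ) : ℝ :=
  (struveL (-1) √k - besselI 1 √k) *
      ellipticK (((k - t₃) * (t₁ - t₂)) / ((t₃ - t₂) * (k - t₁))) /
    √(k * (t₂ - t₃) * (t₁ - k))

/-- Every real `3 × 3` matrix has a singular value decomposition. -/
lemma exists_svd (A : Matrix (Fin 3) (Fin 3) ℝ) :
    ∃ U ∈ Matrix.orthogonalGroup (Fin 3) ℝ, ∃ V ∈ Matrix.orthogonalGroup (Fin 3) ℝ,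
      A = U * Matrix.diagonal (singularValue A) * V.transpose := by
  set T := Matrix.toEuclideanLin A with hT
  have hn : Module.finrank ℝ (EuclideanSpace ℝ (Fin 3)) = 3 := by simp
  set e := T.isSymmetric_adjoint_comp_self.eigenvectorBasis hn with he
  have hin : ∀ i j, inner ℝ (T (e i)) (T (e j)) =
      if i = j then singularValue A j ^ 2 else 0 := by
    intro i j
    have h1 : (LinearMap.adjoint T ∘ₗ T) (e j) = (singularValue A j ^ 2) • e j := by
      have h2 := T.isSymmetric_adjoint_comp_self.apply_eigenvectorBasis hn j
      have h3 := T.sq_singularValues_fin hn j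
      rw [← h3] at h2
      exact h2
    have h4 : inner ℝ (T (e i)) (T (e j)) =
        inner ℝ (e i) ((LinearMap.adjoint T ∘ₗ T) (e j)) := by
      rw [LinearMap.comp_apply, LinearMap.adjoint_inner_right]
    rw [h4, h1, inner_smul_right, orthonormal_iff_ite.1 e.orthonormal i j]
    split_ifs <;> simp
  let s : Set (Fin 3) := {i | singularValue A i ≠ 0}
  have hv : Orthonormal ℝ (s.domRestrict fun i => (singularValue A i)⁻¹ • T (e i)) := by
    rw [orthonormal_iff_ite]
    rintro ⟨i, hi⟩ ⟨j, hj⟩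
    rw [Set.domRestrict_apply, Set.domRestrict_apply, real_inner_smul_left,
      real_inner_smul_right, hin]
    simp only [Subtype.mk.injEq]
    split_ifs with h
    · subst h
      have : singularValue A i ≠ 0 := hi
      field_simp
    · simp
  obtain ⟨f, hf⟩ := hv.exists_orthonormalBasis_extension_of_card_eq (by simp)
  have hTe : ∀ j, T (e j) = singularValue A j • f j := by
    intro j
    by_cases h : singularValue A j = 0
    · have h0 := hin j j
      rw [if_pos rfl, h] at h0
      rw [h, zero_smul]
      exact (inner_self_eq_zero (𝕜 := ℝ)).1 (h0.trans (by simp))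
    · rw [hf j h, smul_inv_smul₀ h]
  have horth : ∀ b : OrthonormalBasis (Fin 3) ℝ (EuclideanSpace ℝ (Fin 3)),
      (Matrix.of fun i j => b j i) ∈ Matrix.orthogonalGroup (Fin 3) ℝ := by
    intro b
    rw [Matrix.mem_orthogonalGroup_iff']
    ext i j
    have h := orthonormal_iff_ite.1 b.orthonormal i j
    rw [PiLp.inner_apply] at h
    rw [Matrix.mul_apply, Matrix.one_apply, ← h]
    refine Finset.sum_congr rfl fun k _ => ?_
    simp [mul_comm]
  refine ⟨_, horth f, _, horth e, ?_⟩
  set U : Matrix (Fin 3) (Fin 3) ℝ := Matrix.of fun i j => f j i with hU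
  set V : Matrix (Fin 3) (Fin 3) ℝ := Matrix.of fun i j => e j i with hV
  have hAV : A * V = U * Matrix.diagonal (singularValue A) := by
    ext i j
    have h := congrArg (fun v : EuclideanSpace ℝ (Fin 3) => v i) (hTe j)
    simp only [hT, Matrix.toLpLin_apply, PiLp.smul_apply, smul_eq_mul] at h
    rw [Matrix.mul_diagonal, mul_comm, hU, Matrix.of_apply, ← h]
    rfl
  have hVV : V * V.transpose = 1 := (Matrix.mem_orthogonalGroup_iff _ _).1 (horth e)
  rw [← hAV, Matrix.mul_assoc, hVV, Matrix.mul_one]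

/-- The proper singular values are those of a proper singular value decomposition: one has
`A = U S Vᵀ` with `U`, `V` in `SO(3)` and `s₁ ≥ s₂ ≥ |s₃|`. -/
theorem exists_properSVD (A : Matrix (Fin 3) (Fin 3) ℝ) :
    (properSingularValue A 1 ≤ properSingularValue A 0 ∧
      |properSingularValue A 2| ≤ properSingularValue A 1) ∧
    ∃ U ∈ Matrix.specialOrthogonalGroup (Fin 3) ℝ,
      ∃ V ∈ Matrix.specialOrthogonalGroup (Fin 3) ℝ,
        A = U * Matrix.diagonal (properSingularValue A) * V.transpose := by
  have h10 : singularValue A 1 ≤ singularValue A 0 :=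
    (Matrix.toEuclideanLin A).singularValues_antitone (by decide)
  have h21 : singularValue A 2 ≤ singularValue A 1 :=
    (Matrix.toEuclideanLin A).singularValues_antitone (by decide)
  have h2 : 0 ≤ singularValue A 2 := (Matrix.toEuclideanLin A).singularValues_nonneg _
  refine ⟨⟨h10, ?_⟩, ?_⟩
  · have hs : |(SignType.sign A.det : ℝ)| ≤ 1 := by
      rcases lt_trichotomy A.det 0 with h | h | h <;> simp [h]
    change |(SignType.sign A.det : ℝ) * singularValue A 2| ≤ singularValue A 1
    rw [abs_mul, abs_of_nonneg h2]
    nlinarith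
  obtain ⟨U, hU, V, hV, hA⟩ := exists_svd A
  have hdet : ∀ M ∈ Matrix.orthogonalGroup (Fin 3) ℝ, M.det * M.det = 1 := by
    intro M hM
    have h := congrArg Matrix.det ((Matrix.mem_orthogonalGroup_iff _ _).1 hM)
    rw [Matrix.det_mul, Matrix.det_transpose, Matrix.det_one] at h
    exact h
  have hSO : ∀ M ∈ Matrix.orthogonalGroup (Fin 3) ℝ,
      M * Matrix.diagonal ![1, 1, M.det] ∈ Matrix.specialOrthogonalGroup (Fin 3) ℝ := by
    intro M hM
    rw [Matrix.mem_specialOrthogonalGroup_iff]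
    refine ⟨mul_mem hM ?_, ?_⟩
    · rw [Matrix.mem_orthogonalGroup_iff, Matrix.diagonal_transpose,
        Matrix.diagonal_mul_diagonal, ← Matrix.diagonal_one]
      congr 1
      funext i
      fin_cases i <;> simp [hdet M hM]
    · rw [Matrix.det_mul, Matrix.det_diagonal, Fin.prod_univ_three]
      simpa using hdet M hM
  refine ⟨_, hSO U hU, _, hSO V hV, ?_⟩
  have hsign : U.det * ((SignType.sign A.det : ℝ) * singularValue A 2) * V.det =
      singularValue A 2 := by
    rcases h2.eq_or_lt with h0 | hpos
    · rw [← h0]; ring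
    · have hp : 0 < singularValue A 0 * singularValue A 1 * singularValue A 2 := by
        have h1 := hpos.trans_le h21
        have h0 := h1.trans_le h10
        positivity
      have hdA : A.det = U.det * V.det *
          (singularValue A 0 * singularValue A 1 * singularValue A 2) := by
        conv_lhs => rw [hA]
        rw [Matrix.det_mul, Matrix.det_mul, Matrix.det_transpose, Matrix.det_diagonal,
          Fin.prod_univ_three]
        ring
      rcases mul_self_eq_one_iff.1 (hdet U hU) with hu | hu <;>
        rcases mul_self_eq_one_iff.1 (hdet V hV) with hw | hw <;>
        rw [hu, hw] at hdA <;> rw [hu, hw]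
      · rw [sign_pos (by linarith)]; simp
      · rw [sign_neg (by linarith)]; simp
      · rw [sign_neg (by linarith)]; simp
      · rw [sign_pos (by linarith)]; simp
  have hdiag : Matrix.diagonal ![1, 1, U.det] * Matrix.diagonal (properSingularValue A) *
      Matrix.diagonal ![1, 1, V.det] = Matrix.diagonal (singularValue A) := by
    rw [Matrix.diagonal_mul_diagonal, Matrix.diagonal_mul_diagonal]
    congr 1
    funext i
    fin_cases i
    · simp [properSingularValue]
    · simp [properSingularValue]
    · simpa [properSingularValue] using hsign
  rw [Matrix.transpose_mul, Matrix.diagonal_transpose]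
  conv_lhs => rw [hA, ← hdiag]
  simp only [Matrix.mul_assoc]

end RotationLaplace

/-!
By bi-invariance of Haar measure and the proper singular value decomposition, `F(A)` depends only
on `S`, and the argument of the density may be taken to be `tr (S - S R)`. Haar measure is the law
of the rotation `x ↦ v x v⁻¹` of a quaternion `v` chosen uniformly in the unit ball: this law is
left invariant, because left multiplication by a unit quaternion preserves Lebesgue measure and
every rotation comes from a unit quaternion (`map_quatRotation`). In terms of `v = v₀ + u`, with
`u` imaginary, one has `tr (S - S R) = (t₁ v₁² + t₂ v₂² + t₃ v₃²) / |v|²`, which is `k sin² α`,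
where `α` is the angle between `v` and the real axis and `k` is the value at `u / |u|` of the
quadratic form with coefficients `t₁, t₂, t₃` (`lintegral_quatBall_spherical`).

The integral over `α` is elementary up to expanding an exponential:
`∫ sin α exp (-√k sin α) dα` over `[0, π/2]` equals `π/2 (L₋₁(√k) - I₁(√k))` by Wallis's formulas
(`integral_sin_mul_exp_neg_mul_sin`, `laplaceAverage_eq`). There remains the law of `k` for a
uniform point of the sphere, that is, of an octant. For values below `t₂` take the first axis as
polar axis, so that `k = t₁ cos² β + C(φ) sin² β` with `C(φ) = t₂ cos² φ + t₃ sin² φ ≥ t₂`.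
Replacing `β` by `k` and exchanging the integrals leaves, for fixed `k`, an integral over `φ` which
the substitution `√(t₃ - k) tan φ = √(t₂ - k) tan θ` turns into a complete elliptic integral
(`octantIntegral_of_lt`). Values above `t₂` reduce to this case by exchanging the first and the
third axis and changing the sign of the form (`octantIntegral_swap`, `octantIntegral_neg`).

Everything is done with integrals of nonnegative functions, so that convergence of all integrals
follows at the end from a single bound, `octantIntegral_laplaceAverage_ne_top`.
-/

open MeasureTheory

namespace RotationLaplace

/-! ### Rotations and quaternions -/

/-- The squared norm of the quaternion with coordinates `v`. -/
def quatNormSq (v : Fin 4 → ℝ) : ℝ := v 0 ^ 2 + v 1 ^ 2 + v 2 ^ 2 + v 3 ^ 2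

/-- The matrix of left multiplication by the quaternion with coordinates `p`. -/
def quatMulMatrix (p : Fin 4 → ℝ) : Matrix (Fin 4) (Fin 4) ℝ :=
  !![p 0, -p 1, -p 2, -p 3;
     p 1, p 0, -p 3, p 2;
     p 2, p 3, p 0, -p 1;
     p 3, -p 2, p 1, p 0]

/-- The matrix of `x ↦ v x v̄` on the imaginary quaternions: `|v|²` times a rotation. -/
def quatConj (v : Fin 4 → ℝ) : Matrix (Fin 3) (Fin 3) ℝ :=
  !![v 0 ^ 2 + v 1 ^ 2 - v 2 ^ 2 - v 3 ^ 2, 2 * (v 1 * v 2 - v 0 * v 3),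
       2 * (v 1 * v 3 + v 0 * v 2);
     2 * (v 1 * v 2 + v 0 * v 3), v 0 ^ 2 - v 1 ^ 2 + v 2 ^ 2 - v 3 ^ 2,
       2 * (v 2 * v 3 - v 0 * v 1);
     2 * (v 1 * v 3 - v 0 * v 2), 2 * (v 2 * v 3 + v 0 * v 1),
       v 0 ^ 2 - v 1 ^ 2 - v 2 ^ 2 + v 3 ^ 2]

lemma quatNormSq_eq_zero {v : Fin 4 → ℝ} : quatNormSq v = 0 ↔ v = 0 := by
  constructor
  · intro h
    unfold quatNormSq at h
    funext i
    fin_cases i <;> simp <;> nlinarith [sq_nonneg (v 0), sq_nonneg (v 1), sq_nonneg (v 2),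
      sq_nonneg (v 3)]
  · rintro rfl
    simp [quatNormSq]

lemma quatNormSq_smul (c : ℝ) (v : Fin 4 → ℝ) : quatNormSq (c • v) = c ^ 2 * quatNormSq v := by
  simp only [quatNormSq, Pi.smul_apply, smul_eq_mul]; ring

lemma quatConj_smul (c : ℝ) (v : Fin 4 → ℝ) : quatConj (c • v) = c ^ 2 • quatConj v := by
  ext i j
  fin_cases i <;> fin_cases j <;> simp [quatConj] <;> ring

lemma quatMulMatrix_mulVec (p v : Fin 4 → ℝ) : (quatMulMatrix p).mulVec v =
    ![p 0 * v 0 - p 1 * v 1 - p 2 * v 2 - p 3 * v 3,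
      p 0 * v 1 + p 1 * v 0 + p 2 * v 3 - p 3 * v 2,
      p 0 * v 2 - p 1 * v 3 + p 2 * v 0 + p 3 * v 1,
      p 0 * v 3 + p 1 * v 2 - p 2 * v 1 + p 3 * v 0] := by
  funext i
  fin_cases i <;> simp [quatMulMatrix, Matrix.mulVec, dotProduct, Fin.sum_univ_four] <;> ring

lemma quatNormSq_mulVec (p v : Fin 4 → ℝ) :
    quatNormSq ((quatMulMatrix p).mulVec v) = quatNormSq p * quatNormSq v := by
  rw [quatMulMatrix_mulVec]
  simp [quatNormSq]; ring

lemma quatConj_mulVec (p v : Fin 4 → ℝ) :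
    quatConj ((quatMulMatrix p).mulVec v) = quatConj p * quatConj v := by
  rw [quatMulMatrix_mulVec]
  ext i j
  fin_cases i <;> fin_cases j <;>
    simp [quatConj, Matrix.mul_apply, Fin.sum_univ_three] <;> ring

lemma det_quatMulMatrix (p : Fin 4 → ℝ) : (quatMulMatrix p).det = quatNormSq p ^ 2 := by
  simp [quatMulMatrix, Matrix.det_succ_row_zero, Fin.sum_univ_succ, Fin.succAbove, quatNormSq]
  ring

lemma quatConj_mul_transpose (v : Fin 4 → ℝ) :
    quatConj v * (quatConj v).transpose = (quatNormSq v ^ 2) • (1 : Matrix (Fin 3) (Fin 3) ℝ) := by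
  ext i j
  fin_cases i <;> fin_cases j <;>
    simp [quatConj, Matrix.mul_apply, Fin.sum_univ_three, quatNormSq] <;> ring

lemma det_quatConj (v : Fin 4 → ℝ) : (quatConj v).det = quatNormSq v ^ 3 := by
  simp [quatConj, Matrix.det_fin_three, quatNormSq]; ring

lemma normalized_quatConj_mem {v : Fin 4 → ℝ} (hv : quatNormSq v ≠ 0) :
    (quatNormSq v)⁻¹ • quatConj v ∈ Matrix.specialOrthogonalGroup (Fin 3) ℝ := by
  rw [Matrix.mem_specialOrthogonalGroup_iff, Matrix.mem_orthogonalGroup_iff]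
  constructor
  · rw [Matrix.transpose_smul, Matrix.smul_mul, Matrix.mul_smul, quatConj_mul_transpose,
      smul_smul, smul_smul]
    convert one_smul ℝ _
    field_simp
  · rw [Matrix.det_smul, det_quatConj]
    simp only [Fintype.card_fin]
    field_simp

open Classical in
/-- The rotation of a quaternion: `x ↦ v x v⁻¹` on the imaginary quaternions, and the identity
for `v = 0`. -/
noncomputable def quatRotation (v : Fin 4 → ℝ) : SO3 :=
  if hv : quatNormSq v = 0 then 1 else ⟨_, normalized_quatConj_mem hv⟩

lemma coe_quatRotation {v : Fin 4 → ℝ} (hv : quatNormSq v ≠ 0) :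
    (quatRotation v : Matrix (Fin 3) (Fin 3) ℝ) = (quatNormSq v)⁻¹ • quatConj v := by
  simp [quatRotation, hv]

lemma quatRotation_mulVec {p v : Fin 4 → ℝ} (hp : quatNormSq p = 1) (hv : quatNormSq v ≠ 0) :
    quatRotation ((quatMulMatrix p).mulVec v) = quatRotation p * quatRotation v := by
  have hN : quatNormSq ((quatMulMatrix p).mulVec v) = quatNormSq v := by
    rw [quatNormSq_mulVec, hp, one_mul]
  apply Subtype.ext
  rw [coe_quatRotation (by rwa [hN])]
  change _ = (quatRotation p : Matrix (Fin 3) (Fin 3) ℝ) *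
    (quatRotation v : Matrix (Fin 3) (Fin 3) ℝ)
  rw [coe_quatRotation (by rw [hp]; exact one_ne_zero), coe_quatRotation hv, hN, hp,
    quatConj_mulVec, inv_one, one_smul, Matrix.mul_smul]

/-- A rotation `R` whose trace exceeds `-1` comes from the quaternion
`(1 + tr R, R₂₁ - R₁₂, R₀₂ - R₂₀, R₁₀ - R₀₁)`. -/
lemma exists_quatConj_eq_of_trace {R : Matrix (Fin 3) (Fin 3) ℝ}
    (hR : R ∈ Matrix.specialOrthogonalGroup (Fin 3) ℝ) (htr : 0 < 1 + R.trace) :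
    ∃ v, quatNormSq v = 1 ∧ quatConj v = R := by
  rw [Matrix.mem_specialOrthogonalGroup_iff] at hR
  obtain ⟨hO, hdet⟩ := hR
  have h1 := (Matrix.mem_orthogonalGroup_iff _ _).1 hO
  have h2 := (Matrix.mem_orthogonalGroup_iff' _ _).1 hO
  have h3 : R.adjugate = R.transpose := by
    have h := R.mul_adjugate
    rw [hdet, one_smul] at h
    calc R.adjugate = (R.transpose * R) * R.adjugate := by rw [h2, one_mul]
      _ = R.transpose := by rw [Matrix.mul_assoc, h, mul_one]
  -- every identity below is a linear combination, with constant coefficients, of the entries of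
  -- `R Rᵀ = 1`, `Rᵀ R = 1` and `adj R = Rᵀ`, which `linarith` finds
  set w : Fin 4 → ℝ := ![1 + R 0 0 + R 1 1 + R 2 2, R 2 1 - R 1 2, R 0 2 - R 2 0, R 1 0 - R 0 1]
    with hw
  have e1 := fun i j => congrFun (congrFun h1 i) j
  have e2 := fun i j => congrFun (congrFun h2 i) j
  have e3 := fun i j => congrFun (congrFun h3 i) j
  simp only [Matrix.mul_apply, Fin.sum_univ_three, Matrix.transpose_apply, Matrix.one_apply]
    at e1 e2
  simp only [Matrix.adjugate_fin_three, Matrix.transpose_apply, Matrix.of_apply] at e3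
  have a00 := e1 0 0
  have a01 := e1 0 1
  have a02 := e1 0 2
  have a11 := e1 1 1
  have a12 := e1 1 2
  have a22 := e1 2 2
  have b00 := e2 0 0
  have b01 := e2 0 1
  have b02 := e2 0 2
  have b11 := e2 1 1
  have b12 := e2 1 2
  have b22 := e2 2 2
  have c00 := e3 0 0
  have c01 := e3 0 1
  have c02 := e3 0 2
  have c10 := e3 1 0
  have c11 := e3 1 1
  have c12 := e3 1 2
  have c20 := e3 2 0
  have c21 := e3 2 1
  have c22 := e3 2 2
  clear e1 e2 e3
  simp at a00 a01 a02 a11 a12 a22 b00 b01 b02 b11 b12 b22 c00 c01 c02 c10 c11 c12 c20 c21 c22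
  have hN : quatNormSq w = 4 * (1 + R.trace) := by
    simp [quatNormSq, hw, Matrix.trace, Fin.sum_univ_three]
    linarith
  have hQ : quatConj w = (4 * (1 + R.trace)) • R := by
    ext i j
    fin_cases i <;> fin_cases j <;>
      simp [quatConj, hw, Matrix.trace, Fin.sum_univ_three] <;> linarith
  refine ⟨(√(4 * (1 + R.trace)))⁻¹ • w, ?_, ?_⟩
  · rw [quatNormSq_smul, hN, inv_pow, Real.sq_sqrt (by linarith)]
    exact inv_mul_cancel₀ (by linarith)
  · rw [quatConj_smul, hQ, inv_pow, Real.sq_sqrt (by linarith), smul_smul,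
      inv_mul_cancel₀ (by linarith), one_smul]

/-- Every rotation comes from a unit quaternion. The traces of the four products of `R` with the
identity and the half-turns about the coordinate axes sum to `0`, so one of them exceeds `-1`. -/
lemma exists_quatConj_eq {R : Matrix (Fin 3) (Fin 3) ℝ}
    (hR : R ∈ Matrix.specialOrthogonalGroup (Fin 3) ℝ) :
    ∃ v, quatNormSq v = 1 ∧ quatConj v = R := by
  have key : ∀ e : Fin 4 → ℝ, quatNormSq e = 1 → quatConj e * quatConj e = 1 →
      0 < 1 + (R * quatConj e).trace → ∃ v, quatNormSq v = 1 ∧ quatConj v = R := by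
    intro e he hee htr
    have hmem : quatConj e ∈ Matrix.specialOrthogonalGroup (Fin 3) ℝ := by
      have h := normalized_quatConj_mem (v := e) (by rw [he]; exact one_ne_zero)
      rwa [he, inv_one, one_smul] at h
    obtain ⟨v, hv, hvR⟩ := exists_quatConj_eq_of_trace (mul_mem hR hmem) htr
    refine ⟨(quatMulMatrix v).mulVec e, ?_, ?_⟩
    · rw [quatNormSq_mulVec, hv, he, one_mul]
    · rw [quatConj_mulVec, hvR, Matrix.mul_assoc, hee, Matrix.mul_one]
  have hsq : ∀ i : Fin 4, quatConj (Pi.single i 1) * quatConj (Pi.single i 1) = 1 := by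
    intro i
    ext j k
    fin_cases i <;> fin_cases j <;> fin_cases k <;>
      simp [quatConj, Matrix.mul_apply, Fin.sum_univ_three]
  have hone : ∀ i : Fin 4, quatNormSq (Pi.single i 1) = 1 := by
    intro i
    fin_cases i <;> simp [quatNormSq]
  have hsum : ∑ i : Fin 4, (1 + (R * quatConj (Pi.single i 1)).trace) = 4 := by
    simp [Fin.sum_univ_four, quatConj, Matrix.trace, Matrix.mul_apply, Fin.sum_univ_three]
    ring
  obtain ⟨i, -, hi⟩ : ∃ i ∈ Finset.univ, 0 < 1 + (R * quatConj (Pi.single i 1)).trace := by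
    apply Finset.exists_lt_of_sum_lt
    rw [hsum]
    norm_num
  exact key _ (hone i) (hsq i) hi

instance : SecondCountableTopology SO3 := by
  have : SecondCountableTopology (Matrix (Fin 3) (Fin 3) ℝ) :=
    inferInstanceAs (SecondCountableTopology (Fin 3 → Fin 3 → ℝ))
  exact TopologicalSpace.Subtype.secondCountableTopology _

lemma continuous_quatNormSq : Continuous quatNormSq := by
  unfold quatNormSq; fun_prop

lemma measurable_quatNormSq : Measurable quatNormSq := continuous_quatNormSq.measurable

lemma continuous_quatConj : Continuous quatConj := by
  refine continuous_matrix fun i j => ?_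
  fin_cases i <;> fin_cases j <;> simp [quatConj] <;> fun_prop

lemma measurable_quatRotation : Measurable quatRotation := by
  refine measurable_of_continuousOn_compl_singleton 0 ?_
  rw [continuousOn_iff_continuous_domRestrict]
  have h0 : ∀ v : ({0}ᶜ : Set (Fin 4 → ℝ)), quatNormSq v ≠ 0 := fun v h =>
    v.2 (quatNormSq_eq_zero.1 h)
  refine Continuous.congr (f := fun v : ({0}ᶜ : Set (Fin 4 → ℝ)) =>
    (⟨_, normalized_quatConj_mem (h0 v)⟩ : SO3)) ?_ ?_
  · refine Continuous.subtype_mk ?_ _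
    have h1 : Continuous fun v : ({0}ᶜ : Set (Fin 4 → ℝ)) => (quatNormSq v)⁻¹ := by
      exact Continuous.inv₀ (continuous_quatNormSq.comp continuous_subtype_val) h0
    exact h1.smul (continuous_quatConj.comp continuous_subtype_val)
  · intro v
    simp [quatRotation, h0 v]

/-- Lebesgue measure on the unit ball of the quaternions. -/
noncomputable def quatBall : Measure (Fin 4 → ℝ) := volume.restrict {v | quatNormSq v < 1}

lemma measurableSet_quatBall : MeasurableSet {v : Fin 4 → ℝ | quatNormSq v < 1} :=
  measurableSet_lt measurable_quatNormSq measurable_const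

lemma measurePreserving_quatMul {p : Fin 4 → ℝ} (hp : quatNormSq p = 1) :
    MeasurePreserving (fun v => (quatMulMatrix p).mulVec v) quatBall quatBall := by
  have hvol : MeasurePreserving (fun v => (quatMulMatrix p).mulVec v) volume volume := by
    refine ⟨?_, ?_⟩
    · exact (Continuous.matrix_mulVec continuous_const continuous_id).measurable
    · have h := Real.map_matrix_volume_pi_eq_smul_volume_pi (M := quatMulMatrix p)
        (by rw [det_quatMulMatrix, hp]; norm_num)
      rw [det_quatMulMatrix, hp] at h
      simp only [one_pow, inv_one, abs_one, ENNReal.ofReal_one, one_smul] at h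
      exact h
  have h := hvol.restrict_preimage measurableSet_quatBall
  have hpre : (fun v => (quatMulMatrix p).mulVec v) ⁻¹' {v : Fin 4 → ℝ | quatNormSq v < 1} =
      {v : Fin 4 → ℝ | quatNormSq v < 1} := by
    ext v
    simp [quatNormSq_mulVec, hp]
  rwa [hpre] at h

lemma ae_quatNormSq_ne_zero : ∀ᵐ v ∂quatBall, quatNormSq v ≠ 0 := by
  have h : ∀ᵐ v ∂(volume : Measure (Fin 4 → ℝ)), v ≠ 0 := Measure.ae_ne volume 0
  filter_upwards [ae_restrict_of_ae h] with v hv h0 using hv (quatNormSq_eq_zero.1 h0)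

/-- The law of the rotation of a random quaternion is left invariant: every rotation is that of a
unit quaternion, and left multiplication by a unit quaternion preserves Lebesgue measure. -/
instance : (quatBall.map quatRotation).IsMulLeftInvariant := by
  refine ⟨fun g => ?_⟩
  obtain ⟨p, hp, hpg⟩ := exists_quatConj_eq g.2
  have hg : quatRotation p = g := by
    apply Subtype.ext
    rw [coe_quatRotation (by rw [hp]; exact one_ne_zero), hp, inv_one, one_smul, hpg]
  rw [Measure.map_map (measurable_const_mul g) measurable_quatRotation]
  have hcongr : ((g * ·) ∘ quatRotation) =ᵐ[quatBall]
      quatRotation ∘ fun v => (quatMulMatrix p).mulVec v := by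
    filter_upwards [ae_quatNormSq_ne_zero] with v hv
    simp only [Function.comp_apply]
    rw [quatRotation_mulVec hp hv, hg]
  rw [Measure.map_congr hcongr, ← Measure.map_map measurable_quatRotation
    (measurePreserving_quatMul hp).measurable, (measurePreserving_quatMul hp).map_eq]

/-- Haar measure on `SO(3)`, up to the volume of the ball, as the law of the rotation of a random
quaternion. -/
lemma map_quatRotation (hfin : quatBall Set.univ ≠ ⊤) :
    quatBall.map quatRotation = quatBall Set.univ • haarSO3 := by
  have : IsFiniteMeasure quatBall := ⟨lt_top_iff_ne_top.2 hfin⟩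
  have h := Measure.haarMeasure_unique (quatBall.map quatRotation)
    (⊤ : TopologicalSpace.PositiveCompacts SO3)
  rw [h]
  congr 1
  simp [Measure.map_apply measurable_quatRotation]

lemma lintegral_haarSO3 {h : SO3 → ENNReal} (hh : Measurable h) (hfin : quatBall Set.univ ≠ ⊤) :
    quatBall Set.univ * ∫⁻ R, h R ∂haarSO3 = ∫⁻ v, h (quatRotation v) ∂quatBall := by
  rw [← lintegral_map hh measurable_quatRotation, map_quatRotation hfin, lintegral_smul_measure,
    smul_eq_mul]

instance : haarSO3.IsMulLeftInvariant := by unfold haarSO3; infer_instance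

/-- The group is compact: a right translate of Haar measure is a left invariant probability
measure, hence Haar measure itself. -/
instance : haarSO3.IsMulRightInvariant := by
  refine ⟨fun g => ?_⟩
  have : IsProbabilityMeasure (haarSO3.map (· * g)) :=
    Measure.isProbabilityMeasure_map (measurable_mul_const g).aemeasurable
  have h := Measure.haarMeasure_unique (haarSO3.map (· * g))
    (⊤ : TopologicalSpace.PositiveCompacts SO3)
  rw [h, TopologicalSpace.PositiveCompacts.coe_top, measure_univ, one_smul, haarSO3]

/-- The radial profile `x ↦ exp (-√x) / √x` of the rotation Laplace density. -/
noncomputable def laplaceProfile (x : ℝ) : ℝ := Real.exp (-√x) / √x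

lemma laplaceProfile_nonneg (x : ℝ) : 0 ≤ laplaceProfile x := by
  unfold laplaceProfile; positivity

lemma measurable_laplaceProfile : Measurable laplaceProfile := by
  unfold laplaceProfile; fun_prop

lemma trace_diagonal_sub_quatRotation (s : Fin 3 → ℝ) {v : Fin 4 → ℝ} (hv : quatNormSq v ≠ 0) :
    (Matrix.diagonal s - Matrix.diagonal s * (quatRotation v : Matrix (Fin 3) (Fin 3) ℝ)).trace =
      (2 * (s 1 + s 2) * v 1 ^ 2 + 2 * (s 0 + s 2) * v 2 ^ 2 + 2 * (s 0 + s 1) * v 3 ^ 2) /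
        quatNormSq v := by
  rw [coe_quatRotation hv, eq_div_iff hv]
  have h : ∀ i, (quatNormSq v)⁻¹ * quatConj v i i * quatNormSq v = quatConj v i i := by
    intro i; field_simp
  simp only [Matrix.trace, Fin.sum_univ_three, Matrix.diag_apply, Matrix.sub_apply,
    Matrix.diagonal_apply_eq, Matrix.diagonal_mul, Matrix.smul_apply, smul_eq_mul]
  have h0 := h 0
  have h1 := h 1
  have h2 := h 2
  simp only [quatConj, Matrix.of_apply, Matrix.cons_val', Matrix.cons_val] at h0 h1 h2 ⊢
  simp only [quatNormSq] at h0 h1 h2 ⊢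
  linear_combination -s 0 * h0 - s 1 * h1 - s 2 * h2

lemma measurable_unnormalizedDensity (A : Matrix (Fin 3) (Fin 3) ℝ) :
    Measurable (unnormalizedDensity A) := by
  have h : Measurable fun R : SO3 => (Matrix.diagonal (properSingularValue A) -
      A.transpose * (R : Matrix (Fin 3) (Fin 3) ℝ)).trace := by
    refine Continuous.measurable ?_
    refine Continuous.matrix_trace ?_
    exact continuous_const.sub (continuous_const.matrix_mul continuous_subtype_val)
  exact measurable_laplaceProfile.comp h

/-- By bi-invariance of Haar measure only the proper singular values of `A` matter. -/
lemma lintegral_unnormalizedDensity (A : Matrix (Fin 3) (Fin 3) ℝ)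
    (hfin : quatBall Set.univ ≠ ⊤) :
    quatBall Set.univ * ∫⁻ R, ENNReal.ofReal (unnormalizedDensity A R) ∂haarSO3 =
      ∫⁻ v, ENNReal.ofReal (laplaceProfile
        ((2 * (properSingularValue A 1 + properSingularValue A 2) * v 1 ^ 2 +
          2 * (properSingularValue A 0 + properSingularValue A 2) * v 2 ^ 2 +
          2 * (properSingularValue A 0 + properSingularValue A 1) * v 3 ^ 2) /
            quatNormSq v)) ∂quatBall := by
  obtain ⟨-, U, hU, V, hV, hA⟩ := exists_properSVD A
  set S := Matrix.diagonal (properSingularValue A) with hS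
  set h : SO3 → ENNReal := fun R => ENNReal.ofReal (laplaceProfile
    (S - S * (R : Matrix (Fin 3) (Fin 3) ℝ)).trace) with hh
  have hmeas : Measurable h := by
    have h1 : Measurable fun R : SO3 => (S - S * (R : Matrix (Fin 3) (Fin 3) ℝ)).trace := by
      refine Continuous.measurable ?_
      refine Continuous.matrix_trace ?_
      exact continuous_const.sub (continuous_const.matrix_mul continuous_subtype_val)
    exact (measurable_laplaceProfile.comp h1).ennreal_ofReal
  have hdens : ∀ R : SO3, ENNReal.ofReal (unnormalizedDensity A R) =
      h ((⟨U, hU⟩ : SO3)⁻¹ * (R * ⟨V, hV⟩)) := by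
    intro R
    have htr : (S - A.transpose * (R : Matrix (Fin 3) (Fin 3) ℝ)).trace =
        (S - S * (U.transpose * ((R : Matrix (Fin 3) (Fin 3) ℝ) * V))).trace := by
      rw [Matrix.trace_sub, Matrix.trace_sub]
      congr 1
      conv_lhs => rw [hA]
      rw [Matrix.transpose_mul, Matrix.transpose_mul, Matrix.transpose_transpose, hS,
        Matrix.diagonal_transpose, Matrix.mul_assoc, Matrix.trace_mul_comm]
      simp only [Matrix.mul_assoc]
    change ENNReal.ofReal (laplaceProfile
      (S - A.transpose * (R : Matrix (Fin 3) (Fin 3) ℝ)).trace) = _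
    rw [htr]
    rfl
  rw [lintegral_congr hdens, lintegral_mul_right_eq_self (fun R => h ((⟨U, hU⟩ : SO3)⁻¹ * R)),
    lintegral_mul_left_eq_self, lintegral_haarSO3 hmeas hfin]
  refine lintegral_congr_ae ?_
  filter_upwards [ae_quatNormSq_ne_zero] with v hv
  rw [hh]
  simp only
  rw [hS, trace_diagonal_sub_quatRotation _ hv]

/-! ### Spherical coordinates on the quaternions -/

open Set Real in
/-- Polar coordinates on the open first quadrant. -/
lemma lintegral_quadrant_polar {F : ℝ → ℝ → ENNReal} (hF : Measurable (Function.uncurry F)) :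
    ∫⁻ x in Ioi (0 : ℝ), ∫⁻ y in Ioi (0 : ℝ), F x y =
      ∫⁻ r in Ioi (0 : ℝ), ∫⁻ θ in Ioo (0 : ℝ) (π / 2),
        ENNReal.ofReal r * F (r * cos θ) (r * sin θ) := by
  have hm : Measurable fun p : ℝ × ℝ =>
      ENNReal.ofReal p.1 * F (p.1 * cos p.2) (p.1 * sin p.2) := by
    have h1 : Measurable fun p : ℝ × ℝ => (p.1 * cos p.2, p.1 * sin p.2) := by fun_prop
    exact (ENNReal.measurable_ofReal.comp measurable_fst).mul (hF.comp h1)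
  have hQ : MeasurableSet (Ioi (0 : ℝ) ×ˢ Ioi (0 : ℝ)) := measurableSet_Ioi.prod measurableSet_Ioi
  have hL : ∫⁻ x in Ioi (0 : ℝ), ∫⁻ y in Ioi (0 : ℝ), F x y =
      ∫⁻ p, (Ioi (0 : ℝ) ×ˢ Ioi (0 : ℝ)).indicator (Function.uncurry F) p := by
    rw [lintegral_indicator hQ, Measure.volume_eq_prod, ← Measure.prod_restrict,
      lintegral_prod _ hF.aemeasurable]
    rfl
  have hR : ∫⁻ r in Ioi (0 : ℝ), ∫⁻ θ in Ioo (0 : ℝ) (π / 2),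
        ENNReal.ofReal r * F (r * cos θ) (r * sin θ) =
      ∫⁻ p in Ioi (0 : ℝ) ×ˢ Ioo (0 : ℝ) (π / 2),
        ENNReal.ofReal p.1 * F (p.1 * cos p.2) (p.1 * sin p.2) := by
    rw [Measure.volume_eq_prod, ← Measure.prod_restrict, lintegral_prod _ hm.aemeasurable]
  rw [hL, hR, ← lintegral_comp_polarCoord_symm]
  have hsub : Ioi (0 : ℝ) ×ˢ Ioo (0 : ℝ) (π / 2) =
      (Ioi (0 : ℝ) ×ˢ Ioo (0 : ℝ) (π / 2)) ∩ polarCoord.target := by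
    rw [polarCoord_target, prod_inter_prod, inter_self]
    congr 1
    exact (inter_eq_left.2 (Ioo_subset_Ioo (by linarith [pi_pos]) (by linarith [pi_pos]))).symm
  rw [hsub, ← setLIntegral_indicator (measurableSet_Ioi.prod measurableSet_Ioo)]
  refine setLIntegral_congr_fun polarCoord.open_target.measurableSet ?_
  rintro ⟨r, θ⟩ hp
  rw [polarCoord_target] at hp
  obtain ⟨hr, hθ1, hθ2⟩ := hp
  simp only [mem_Ioi] at hr
  have hiff : ((r * cos θ, r * sin θ) ∈ Ioi (0 : ℝ) ×ˢ Ioi (0 : ℝ)) ↔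
      ((r, θ) ∈ Ioi (0 : ℝ) ×ˢ Ioo (0 : ℝ) (π / 2)) := by
    simp only [mem_prod, mem_Ioi, mem_Ioo, hr, true_and, mul_pos_iff_of_pos_left]
    simp only at hθ1 hθ2
    constructor
    · rintro ⟨hc, hs⟩
      constructor
      · by_contra! h
        linarith [sin_nonpos_of_nonpos_of_neg_pi_le h hθ1.le]
      · by_contra! h
        linarith [cos_nonpos_of_pi_div_two_le_of_le h (by linarith)]
    · rintro ⟨h1, h2⟩
      exact ⟨cos_pos_of_mem_Ioo ⟨by linarith, h2⟩, sin_pos_of_pos_of_lt_pi h1 hθ2⟩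
  simp only [polarCoord_symm_apply, smul_eq_mul]
  by_cases h : (r, θ) ∈ Ioi (0 : ℝ) ×ˢ Ioo (0 : ℝ) (π / 2)
  · rw [indicator_of_mem h, indicator_of_mem (hiff.2 h)]
    rfl
  · rw [indicator_of_notMem h, indicator_of_notMem (fun h' => h (hiff.1 h')), mul_zero]

open Set in
lemma lintegral_even {F : ℝ → ENNReal} (hF : ∀ x, F (-x) = F x) :
    ∫⁻ x, F x = 2 * ∫⁻ x in Ioi (0 : ℝ), F x := by
  have h := (Measure.measurePreserving_neg (volume : Measure ℝ)).setLIntegral_comp_preimage_emb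
    (MeasurableEquiv.neg ℝ).measurableEmbedding F (Ioi 0)
  have hpre : (Neg.neg : ℝ → ℝ) ⁻¹' Ioi 0 = Iio 0 := by ext; simp
  rw [hpre] at h
  simp only [hF] at h
  rw [← lintegral_add_compl F measurableSet_Ioi (A := Ioi 0), compl_Ioi,
    ← setLIntegral_congr Iio_ae_eq_Iic, h, two_mul]

lemma lintegral_pi_fin_succ {n : ℕ} {f : (Fin (n + 1) → ℝ) → ENNReal} (hf : Measurable f) :
    ∫⁻ v, f v = ∫⁻ x, ∫⁻ w : Fin n → ℝ, f (Fin.cons x w) := by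
  have e := (volume_preserving_piFinSuccAbove (fun _ : Fin (n + 1) => ℝ) 0).symm
  rw [← e.lintegral_comp hf, Measure.volume_eq_prod]
  refine (lintegral_prod (μ := (volume : Measure ℝ)) (ν := (volume : Measure (Fin n → ℝ))) _
    (hf.comp e.measurable).aemeasurable).trans ?_
  refine lintegral_congr fun x => lintegral_congr fun w => congrArg f ?_
  exact Fin.insertNth_zero' x w

open Set in
lemma lintegral_pi_fin_four_even {Φ : ℝ → ℝ → ℝ → ℝ → ENNReal}
    (hΦ : Measurable fun p : ℝ × ℝ × ℝ × ℝ => Φ p.1 p.2.1 p.2.2.1 p.2.2.2) :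
    ∫⁻ v : Fin 4 → ℝ, Φ (v 0 ^ 2) (v 1 ^ 2) (v 2 ^ 2) (v 3 ^ 2) =
      16 * ∫⁻ w in Ioi (0 : ℝ), ∫⁻ x in Ioi (0 : ℝ), ∫⁻ y in Ioi (0 : ℝ), ∫⁻ z in Ioi (0 : ℝ),
        Φ (w ^ 2) (x ^ 2) (y ^ 2) (z ^ 2) := by
  have hm {γ : Type} [MeasurableSpace γ] {f g h k : γ → ℝ} (hf : Measurable f) (hg : Measurable g)
      (hh : Measurable h) (hk : Measurable k) :
      Measurable fun x => Φ (f x ^ 2) (g x ^ 2) (h x ^ 2) (k x ^ 2) :=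
    hΦ.comp (f := fun x => (f x ^ 2, g x ^ 2, h x ^ 2, k x ^ 2)) (by fun_prop)
  rw [lintegral_pi_fin_succ (hm (by fun_prop) (by fun_prop) (by fun_prop) (by fun_prop))]
  have h1 : ∀ w x y : ℝ, ∫⁻ v : Fin 1 → ℝ, Φ (w ^ 2) (x ^ 2) (y ^ 2) (v 0 ^ 2) =
      2 * ∫⁻ z in Ioi (0 : ℝ), Φ (w ^ 2) (x ^ 2) (y ^ 2) (z ^ 2) := by
    intro w x y
    rw [← lintegral_even (by simp)]
    exact (volume_preserving_funUnique (Fin 1) ℝ).lintegral_comp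
      (hm measurable_const measurable_const measurable_const measurable_id)
  have h2 : ∀ w x : ℝ, ∫⁻ v : Fin 2 → ℝ, Φ (w ^ 2) (x ^ 2) (v 0 ^ 2) (v 1 ^ 2) =
      4 * ∫⁻ y in Ioi (0 : ℝ), ∫⁻ z in Ioi (0 : ℝ), Φ (w ^ 2) (x ^ 2) (y ^ 2) (z ^ 2) := by
    intro w x
    rw [lintegral_pi_fin_succ (hm measurable_const measurable_const (by fun_prop) (by fun_prop))]
    have : ∀ y, ∫⁻ v : Fin 1 → ℝ, Φ (w ^ 2) (x ^ 2) ((Fin.cons y v : Fin 2 → ℝ) 0 ^ 2)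
        ((Fin.cons y v : Fin 2 → ℝ) 1 ^ 2) = _ := fun y => h1 w x y
    simp only [this]
    rw [lintegral_const_mul' _ _ (by simp), lintegral_even (by simp), ← mul_assoc]
    norm_num
  have h3 : ∀ w : ℝ, ∫⁻ v : Fin 3 → ℝ, Φ (w ^ 2) (v 0 ^ 2) (v 1 ^ 2) (v 2 ^ 2) =
      8 * ∫⁻ x in Ioi (0 : ℝ), ∫⁻ y in Ioi (0 : ℝ), ∫⁻ z in Ioi (0 : ℝ),
        Φ (w ^ 2) (x ^ 2) (y ^ 2) (z ^ 2) := by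
    intro w
    rw [lintegral_pi_fin_succ (hm measurable_const (by fun_prop) (by fun_prop) (by fun_prop))]
    have : ∀ x, ∫⁻ v : Fin 2 → ℝ, Φ (w ^ 2) ((Fin.cons x v : Fin 3 → ℝ) 0 ^ 2)
        ((Fin.cons x v : Fin 3 → ℝ) 1 ^ 2) ((Fin.cons x v : Fin 3 → ℝ) 2 ^ 2) = _ :=
      fun x => h2 w x
    simp only [this]
    rw [lintegral_const_mul' _ _ (by simp), lintegral_even (by simp), ← mul_assoc]
    norm_num
  have : ∀ w, ∫⁻ v : Fin 3 → ℝ, Φ ((Fin.cons w v : Fin 4 → ℝ) 0 ^ 2)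
      ((Fin.cons w v : Fin 4 → ℝ) 1 ^ 2) ((Fin.cons w v : Fin 4 → ℝ) 2 ^ 2)
      ((Fin.cons w v : Fin 4 → ℝ) 3 ^ 2) = _ := fun w => h3 w
  simp only [this]
  rw [lintegral_const_mul' _ _ (by simp), lintegral_even (by simp), ← mul_assoc]
  norm_num

open Set Real in
/-- Spherical coordinates `(R cos α, R sin α cos β, R sin α sin β cos φ, R sin α sin β sin φ)` on
the positive orthant of `ℝ⁴`. -/
lemma lintegral_orthant_spherical {Φ : ℝ → ℝ → ℝ → ℝ → ENNReal}
    (hΦ : Measurable fun p : ℝ × ℝ × ℝ × ℝ => Φ p.1 p.2.1 p.2.2.1 p.2.2.2) :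
    ∫⁻ w in Ioi (0 : ℝ), ∫⁻ x in Ioi (0 : ℝ), ∫⁻ y in Ioi (0 : ℝ), ∫⁻ z in Ioi (0 : ℝ), Φ w x y z =
      ∫⁻ R in Ioi (0 : ℝ), ∫⁻ α in Ioo (0 : ℝ) (π / 2), ENNReal.ofReal R *
        ∫⁻ β in Ioo (0 : ℝ) (π / 2), ENNReal.ofReal (R * sin α) *
          ∫⁻ φ in Ioo (0 : ℝ) (π / 2), ENNReal.ofReal (R * sin α * sin β) *
            Φ (R * cos α) (R * sin α * cos β) (R * sin α * sin β * cos φ)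
              (R * sin α * sin β * sin φ) := by
  have hm {γ : Type} [MeasurableSpace γ] {f g h k : γ → ℝ} (hf : Measurable f) (hg : Measurable g)
      (hh : Measurable h) (hk : Measurable k) :
      Measurable fun x => Φ (f x) (g x) (h x) (k x) :=
    hΦ.comp (f := fun x => (f x, g x, h x, k x)) (by fun_prop)
  have h1 : ∀ w x, ∫⁻ y in Ioi (0 : ℝ), ∫⁻ z in Ioi (0 : ℝ), Φ w x y z =
      ∫⁻ r in Ioi (0 : ℝ), ∫⁻ φ in Ioo (0 : ℝ) (π / 2), ENNReal.ofReal r *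
        Φ w x (r * cos φ) (r * sin φ) := fun w x =>
    lintegral_quadrant_polar (F := fun y z => Φ w x y z)
      (hm measurable_const measurable_const measurable_fst measurable_snd)
  have m2 : Measurable fun p : ℝ × ℝ × ℝ => ∫⁻ φ in Ioo (0 : ℝ) (π / 2), ENNReal.ofReal p.2.2 *
      Φ p.1 p.2.1 (p.2.2 * cos φ) (p.2.2 * sin φ) := by
    refine Measurable.lintegral_prod_right' (f := fun q : (ℝ × ℝ × ℝ) × ℝ =>
      ENNReal.ofReal q.1.2.2 * Φ q.1.1 q.1.2.1 (q.1.2.2 * cos q.2) (q.1.2.2 * sin q.2)) ?_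
    exact (by fun_prop : Measurable fun q : (ℝ × ℝ × ℝ) × ℝ => ENNReal.ofReal q.1.2.2).mul
      (hm (by fun_prop) (by fun_prop) (by fun_prop) (by fun_prop))
  have h2 : ∀ w, ∫⁻ x in Ioi (0 : ℝ), ∫⁻ r in Ioi (0 : ℝ), ∫⁻ φ in Ioo (0 : ℝ) (π / 2),
      ENNReal.ofReal r * Φ w x (r * cos φ) (r * sin φ) =
      ∫⁻ ρ in Ioi (0 : ℝ), ∫⁻ β in Ioo (0 : ℝ) (π / 2), ENNReal.ofReal ρ *
        ∫⁻ φ in Ioo (0 : ℝ) (π / 2), ENNReal.ofReal (ρ * sin β) *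
          Φ w (ρ * cos β) (ρ * sin β * cos φ) (ρ * sin β * sin φ) := fun w =>
    lintegral_quadrant_polar (F := fun x r => ∫⁻ φ in Ioo (0 : ℝ) (π / 2),
      ENNReal.ofReal r * Φ w x (r * cos φ) (r * sin φ))
      (m2.comp (f := fun p : ℝ × ℝ => (w, p.1, p.2)) (by fun_prop))
  simp only [h1, h2]
  refine lintegral_quadrant_polar (F := fun w ρ => ∫⁻ β in Ioo (0 : ℝ) (π / 2), ENNReal.ofReal ρ *
    ∫⁻ φ in Ioo (0 : ℝ) (π / 2), ENNReal.ofReal (ρ * sin β) *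
      Φ w (ρ * cos β) (ρ * sin β * cos φ) (ρ * sin β * sin φ)) ?_
  refine Measurable.lintegral_prod_right' (f := fun q : (ℝ × ℝ) × ℝ => ENNReal.ofReal q.1.2 *
    ∫⁻ φ in Ioo (0 : ℝ) (π / 2), ENNReal.ofReal (q.1.2 * sin q.2) *
      Φ q.1.1 (q.1.2 * cos q.2) (q.1.2 * sin q.2 * cos φ) (q.1.2 * sin q.2 * sin φ)) ?_
  refine Measurable.mul (by fun_prop) ?_
  exact m2.comp (f := fun q : (ℝ × ℝ) × ℝ => (q.1.1, q.1.2 * cos q.2, q.1.2 * sin q.2))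
    (by fun_prop)

/-- Permuting the imaginary coordinates preserves Lebesgue measure on the ball. -/
lemma lintegral_quatBall_swap (f : (Fin 4 → ℝ) → ENNReal) :
    ∫⁻ v, f (v ∘ Equiv.swap 1 3) ∂quatBall = ∫⁻ v, f v ∂quatBall := by
  have e := (volume_measurePreserving_piCongrLeft (fun _ : Fin 4 => ℝ) (Equiv.swap 1 3))
  have he : ∀ v, MeasurableEquiv.piCongrLeft (fun _ : Fin 4 => ℝ) (Equiv.swap 1 3) v =
      v ∘ Equiv.swap 1 3 := by
    intro v
    funext i
    have h := Equiv.piCongrLeft_apply_apply (fun _ : Fin 4 => ℝ) (Equiv.swap 1 3) v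
      (Equiv.swap 1 3 i)
    rwa [Equiv.swap_apply_self] at h
  have h := e.setLIntegral_comp_preimage_emb (MeasurableEquiv.measurableEmbedding _) f
    {v | quatNormSq v < 1}
  have hpre : (MeasurableEquiv.piCongrLeft (fun _ : Fin 4 => ℝ) (Equiv.swap 1 3)) ⁻¹'
      {v | quatNormSq v < 1} = {v | quatNormSq v < 1} := by
    ext v
    simp only [Set.mem_preimage, Set.mem_ofPred_eq, he, quatNormSq, Function.comp_apply,
      Equiv.swap_apply_left, Equiv.swap_apply_right]
    rw [Equiv.swap_apply_of_ne_of_ne (by decide) (by decide),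
      Equiv.swap_apply_of_ne_of_ne (by decide) (by decide)]
    ring_nf
  rw [hpre] at h
  simp only [he] at h
  exact h

open Set Real in
/-- A function of `s = |Im v|² / |v|²` and of the value `k` of a diagonal quadratic form at
`Im v / |Im v|`, integrated over the unit ball. In spherical coordinates `s = sin² α`, and `k`
depends only on the angles `β` and `φ`. -/
lemma lintegral_quatBall_spherical (a b c : ℝ) {Ψ : ℝ → ℝ → ENNReal}
    (hΨ : Measurable (Function.uncurry Ψ)) :
    ∫⁻ v, Ψ ((v 1 ^ 2 + v 2 ^ 2 + v 3 ^ 2) / quatNormSq v)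
        ((a * v 1 ^ 2 + b * v 2 ^ 2 + c * v 3 ^ 2) / (v 1 ^ 2 + v 2 ^ 2 + v 3 ^ 2)) ∂quatBall =
      4 * ∫⁻ φ in Ioo (0 : ℝ) (π / 2), ∫⁻ β in Ioo (0 : ℝ) (π / 2), ENNReal.ofReal (sin β) *
        ∫⁻ α in Ioo (0 : ℝ) (π / 2), ENNReal.ofReal (sin α ^ 2) *
          Ψ (sin α ^ 2) (a * cos β ^ 2 + (b * cos φ ^ 2 + c * sin φ ^ 2) * sin β ^ 2) := by
  have hm {γ : Type} [MeasurableSpace γ] {f g : γ → ℝ} (hf : Measurable f) (hg : Measurable g) :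
      Measurable fun x => Ψ (f x) (g x) :=
    hΨ.comp (f := fun x => (f x, g x)) (by fun_prop)
  -- the integrand as a function of the squares of the coordinates
  set Φ : ℝ → ℝ → ℝ → ℝ → ENNReal := fun w x y z => (Iio (1 : ℝ)).indicator 1 (w + x + y + z) *
    Ψ ((x + y + z) / (w + x + y + z)) ((a * x + b * y + c * z) / (x + y + z)) with hΦdef
  have hΦ : Measurable fun p : ℝ × ℝ × ℝ × ℝ => Φ p.1 p.2.1 p.2.2.1 p.2.2.2 := by
    refine Measurable.mul ?_ (hm (by fun_prop) (by fun_prop))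
    exact (measurable_one.indicator measurableSet_Iio).comp (by fun_prop)
  have hΦ2 : Measurable fun p : ℝ × ℝ × ℝ × ℝ =>
      Φ (p.1 ^ 2) (p.2.1 ^ 2) (p.2.2.1 ^ 2) (p.2.2.2 ^ 2) :=
    hΦ.comp (f := fun p : ℝ × ℝ × ℝ × ℝ => (p.1 ^ 2, p.2.1 ^ 2, p.2.2.1 ^ 2, p.2.2.2 ^ 2))
      (by fun_prop)
  have hstart : ∫⁻ v, Ψ ((v 1 ^ 2 + v 2 ^ 2 + v 3 ^ 2) / quatNormSq v)
        ((a * v 1 ^ 2 + b * v 2 ^ 2 + c * v 3 ^ 2) / (v 1 ^ 2 + v 2 ^ 2 + v 3 ^ 2)) ∂quatBall =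
      ∫⁻ v : Fin 4 → ℝ, Φ (v 0 ^ 2) (v 1 ^ 2) (v 2 ^ 2) (v 3 ^ 2) := by
    rw [quatBall, ← lintegral_indicator measurableSet_quatBall]
    refine lintegral_congr fun v => ?_
    by_cases hv : quatNormSq v < 1
    · rw [indicator_of_mem (by exact hv), hΦdef]
      simp only
      rw [indicator_of_mem (by exact hv), Pi.one_apply, one_mul]
      rfl
    · rw [indicator_of_notMem (by exact hv), hΦdef]
      simp only
      rw [indicator_of_notMem (by exact hv), zero_mul]
  -- the integrand in spherical coordinates
  have hpt : ∀ R ∈ Ioi (0 : ℝ), ∀ α ∈ Ioo (0 : ℝ) (π / 2), ∀ β ∈ Ioo (0 : ℝ) (π / 2), ∀ φ,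
      Φ ((R * cos α) ^ 2) ((R * sin α * cos β) ^ 2) ((R * sin α * sin β * cos φ) ^ 2)
        ((R * sin α * sin β * sin φ) ^ 2) = (Iio (1 : ℝ)).indicator 1 (R ^ 2) *
        Ψ (sin α ^ 2) (a * cos β ^ 2 + (b * cos φ ^ 2 + c * sin φ ^ 2) * sin β ^ 2) := by
    intro R hR α hα β hβ φ
    have hsα : 0 < sin α := sin_pos_of_pos_of_lt_pi hα.1 (by linarith [hα.2, pi_pos])
    have hR' : R ≠ 0 := ne_of_gt hR
    have e1 : (R * sin α * cos β) ^ 2 + (R * sin α * sin β * cos φ) ^ 2 +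
        (R * sin α * sin β * sin φ) ^ 2 = R ^ 2 * sin α ^ 2 := by
      linear_combination (R * sin α) ^ 2 * (sin_sq_add_cos_sq β) +
        (R * sin α * sin β) ^ 2 * (sin_sq_add_cos_sq φ)
    have e2 : (R * cos α) ^ 2 + (R * sin α * cos β) ^ 2 + (R * sin α * sin β * cos φ) ^ 2 +
        (R * sin α * sin β * sin φ) ^ 2 = R ^ 2 := by
      linear_combination e1 + R ^ 2 * sin_sq_add_cos_sq α
    simp only [hΦdef]
    rw [e1, e2]
    congr 2
    · field_simp
    · field_simp
      ring
  rw [hstart, lintegral_pi_fin_four_even hΦ, lintegral_orthant_spherical hΦ2]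
  -- the radial factor is `∫₀¹ R³ dR`
  have hrad : ∫⁻ R in Ioi (0 : ℝ), ENNReal.ofReal (R ^ 3) * (Iio (1 : ℝ)).indicator 1 (R ^ 2) =
      ENNReal.ofReal (1 / 4) := by
    have h1 : ∫⁻ R in Ioi (0 : ℝ), ENNReal.ofReal (R ^ 3) * (Iio (1 : ℝ)).indicator 1 (R ^ 2) =
        ∫⁻ R in Ioi (0 : ℝ), (Iio (1 : ℝ)).indicator (fun R => ENNReal.ofReal (R ^ 3)) R := by
      refine setLIntegral_congr_fun measurableSet_Ioi fun R hR => ?_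
      have hR' : (0 : ℝ) < R := hR
      by_cases h : R < 1
      · simp [indicator, abs_of_pos hR', h]
      · have : ¬ R ^ 2 < 1 := by nlinarith
        simp [indicator, h, this]
    rw [h1, setLIntegral_indicator measurableSet_Iio, Iio_inter_Ioi,
      ← ofReal_integral_eq_lintegral_ofReal]
    · rw [← integral_Ioc_eq_integral_Ioo, ← intervalIntegral.integral_of_le zero_le_one,
        integral_pow]
      norm_num
    · exact (Continuous.integrableOn_Icc (by fun_prop)).mono_set Ioo_subset_Icc_self
    · exact (ae_restrict_mem measurableSet_Ioo).mono fun R hR => pow_nonneg hR.1.le 3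
  set J : ENNReal := ∫⁻ φ in Ioo (0 : ℝ) (π / 2), ∫⁻ β in Ioo (0 : ℝ) (π / 2),
    ENNReal.ofReal (sin β) * ∫⁻ α in Ioo (0 : ℝ) (π / 2), ENNReal.ofReal (sin α ^ 2) *
          Ψ (sin α ^ 2) (a * cos β ^ 2 + (b * cos φ ^ 2 + c * sin φ ^ 2) * sin β ^ 2) with hJ
  have hJ' : J = ∫⁻ α in Ioo (0 : ℝ) (π / 2), ∫⁻ β in Ioo (0 : ℝ) (π / 2),
      ∫⁻ φ in Ioo (0 : ℝ) (π / 2), ENNReal.ofReal (sin β) * (ENNReal.ofReal (sin α ^ 2) *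
          Ψ (sin α ^ 2) (a * cos β ^ 2 + (b * cos φ ^ 2 + c * sin φ ^ 2) * sin β ^ 2)) := by
    have hg : Measurable fun q : ℝ × ℝ × ℝ => ENNReal.ofReal (sin q.2.1) *
        (ENNReal.ofReal (sin q.1 ^ 2) * Ψ (sin q.1 ^ 2)
          (a * cos q.2.1 ^ 2 + (b * cos q.2.2 ^ 2 + c * sin q.2.2 ^ 2) * sin q.2.1 ^ 2)) :=
      Measurable.mul (by fun_prop) (Measurable.mul (by fun_prop) (hm (by fun_prop) (by fun_prop)))
    rw [hJ]
    simp only [← lintegral_const_mul' _ _ ENNReal.ofReal_ne_top]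
    have s1 : ∀ φ, ∫⁻ β in Ioo (0 : ℝ) (π / 2), ∫⁻ α in Ioo (0 : ℝ) (π / 2),
        ENNReal.ofReal (sin β) * (ENNReal.ofReal (sin α ^ 2) *
          Ψ (sin α ^ 2) (a * cos β ^ 2 + (b * cos φ ^ 2 + c * sin φ ^ 2) * sin β ^ 2)) = _ :=
      fun φ => lintegral_lintegral_swap
        (hg.comp (f := fun p : ℝ × ℝ => (p.2, p.1, φ)) (by fun_prop)).aemeasurable
    simp only [s1]
    rw [lintegral_lintegral_swap]
    · refine lintegral_congr fun α => lintegral_lintegral_swap ?_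
      exact (hg.comp (f := fun p : ℝ × ℝ => (α, p.2, p.1)) (by fun_prop)).aemeasurable
    · refine Measurable.aemeasurable (Measurable.lintegral_prod_right'
        (f := fun q : (ℝ × ℝ) × ℝ => ENNReal.ofReal (sin q.2) * (ENNReal.ofReal (sin q.1.2 ^ 2) *
          Ψ (sin q.1.2 ^ 2) (a * cos q.2 ^ 2 +
            (b * cos q.1.1 ^ 2 + c * sin q.1.1 ^ 2) * sin q.2 ^ 2))) ?_)
      exact hg.comp (f := fun q : (ℝ × ℝ) × ℝ => (q.1.2, q.2, q.1.1)) (by fun_prop)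
  have hfact : ∀ R ∈ Ioi (0 : ℝ), (∫⁻ α in Ioo (0 : ℝ) (π / 2), ENNReal.ofReal R *
        ∫⁻ β in Ioo (0 : ℝ) (π / 2), ENNReal.ofReal (R * sin α) *
          ∫⁻ φ in Ioo (0 : ℝ) (π / 2), ENNReal.ofReal (R * sin α * sin β) *
            Φ ((R * cos α) ^ 2) ((R * sin α * cos β) ^ 2) ((R * sin α * sin β * cos φ) ^ 2)
              ((R * sin α * sin β * sin φ) ^ 2)) =
      (ENNReal.ofReal (R ^ 3) * (Iio (1 : ℝ)).indicator 1 (R ^ 2)) * J := by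
    intro R hR
    have hR0 : (0 : ℝ) < R := hR
    have hK : ENNReal.ofReal (R ^ 3) * (Iio (1 : ℝ)).indicator 1 (R ^ 2) ≠ ⊤ := by
      refine ENNReal.mul_ne_top ENNReal.ofReal_ne_top ?_
      by_cases h : R ^ 2 ∈ Iio (1 : ℝ) <;> simp only [indicator, h] <;> simp
    rw [hJ']
    simp only [← lintegral_const_mul' _ _ ENNReal.ofReal_ne_top, ← lintegral_const_mul' _ _ hK]
    refine setLIntegral_congr_fun measurableSet_Ioo fun α hα => ?_
    refine setLIntegral_congr_fun measurableSet_Ioo fun β hβ => ?_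
    refine lintegral_congr fun φ => ?_
    have hsα : 0 ≤ sin α := (sin_pos_of_pos_of_lt_pi hα.1 (by linarith [hα.2, pi_pos])).le
    have hsβ : 0 ≤ sin β := (sin_pos_of_pos_of_lt_pi hβ.1 (by linarith [hβ.2, pi_pos])).le
    rw [hpt R hR α hα β hβ φ, ENNReal.ofReal_mul (p := R * sin α) (by positivity),
      ENNReal.ofReal_mul (p := R) hR0.le,      ENNReal.ofReal_pow hR0.le, ENNReal.ofReal_pow hsα]
    ring
  rw [setLIntegral_congr_fun measurableSet_Ioi hfact, lintegral_mul_const, hrad, ← mul_assoc]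
  · congr 1
    rw [← ENNReal.ofReal_ofNat 16, ← ENNReal.ofReal_mul (by norm_num)]
    norm_num
  · refine Measurable.mul (by fun_prop) ?_
    exact (measurable_one.indicator measurableSet_Iio).comp (by fun_prop)

/-! ### Quadratic forms on the sphere and elliptic integrals -/

open Set Real in
/-- The substitution `k = a cos² β + c sin² β`. -/
lemma lintegral_sin_mul_comp_quadratic {a c : ℝ} (hac : a < c) (G : ℝ → ENNReal) :
    ∫⁻ β in Ioo (0 : ℝ) (π / 2), ENNReal.ofReal (sin β) * G (a * cos β ^ 2 + c * sin β ^ 2) =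
      ∫⁻ k in Ioo a c, ENNReal.ofReal (1 / (2 * √((c - a) * (c - k)))) * G k := by
  set f : ℝ → ℝ := fun β => a * cos β ^ 2 + c * sin β ^ 2 with hf
  have hfs : ∀ β, f β = a + (c - a) * sin β ^ 2 := fun β => by
    simp only [hf]; linear_combination a * sin_sq_add_cos_sq β
  have hsin : ∀ β ∈ Ioo (0 : ℝ) (π / 2), 0 < sin β := fun β hβ =>
    sin_pos_of_pos_of_lt_pi hβ.1 (by linarith [hβ.2, pi_pos])
  have hcos : ∀ β ∈ Ioo (0 : ℝ) (π / 2), 0 < cos β := fun β hβ =>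
    cos_pos_of_mem_Ioo ⟨by linarith [hβ.1, pi_pos], hβ.2⟩
  have himg : f '' Ioo 0 (π / 2) = Ioo a c := by
    ext k
    constructor
    · rintro ⟨β, hβ, rfl⟩
      have h1 := hsin β hβ
      have h2 := hcos β hβ
      have h3 : 0 < (c - a) * sin β ^ 2 := mul_pos (by linarith) (by positivity)
      have h4 : 0 < (c - a) * cos β ^ 2 := mul_pos (by linarith) (by positivity)
      rw [hfs]
      constructor
      · linarith
      · linarith [show (c - a) * sin β ^ 2 + (c - a) * cos β ^ 2 = c - a by
          linear_combination (c - a) * sin_sq_add_cos_sq β]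
    · rintro ⟨h1, h2⟩
      have hpos : 0 < (k - a) / (c - a) := div_pos (by linarith) (by linarith)
      have hlt : (k - a) / (c - a) < 1 := (div_lt_one (by linarith)).2 (by linarith)
      refine ⟨arcsin √((k - a) / (c - a)), ⟨?_, ?_⟩, ?_⟩
      · exact arcsin_pos.2 (sqrt_pos.2 hpos)
      · rw [arcsin_lt_pi_div_two, sqrt_lt' one_pos]
        simpa using hlt
      · rw [hfs, sin_arcsin (by linarith [sqrt_nonneg ((k - a) / (c - a))])
          (sqrt_le_one.2 hlt.le), sq_sqrt hpos.le]
        have : c - a ≠ 0 := by linarith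
        field_simp
        ring
  have hinj : InjOn f (Ioo 0 (π / 2)) := by
    intro x hx y hy hxy
    rw [hfs, hfs] at hxy
    have h1 : (c - a) * (sin x ^ 2 - sin y ^ 2) = 0 := by linarith
    have h2 : sin x ^ 2 = sin y ^ 2 := by
      rcases mul_eq_zero.1 h1 with h | h <;> linarith
    have h3 : sin x = sin y := (pow_left_inj₀ (hsin x hx).le (hsin y hy).le two_ne_zero).1 h2
    exact injOn_sin ⟨by linarith [hx.1, pi_pos], hx.2.le⟩ ⟨by linarith [hy.1, pi_pos], hy.2.le⟩ h3
  have hder : ∀ β ∈ Ioo (0 : ℝ) (π / 2),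
      HasDerivWithinAt f (2 * (c - a) * (sin β * cos β)) (Ioo 0 (π / 2)) β := by
    intro β _
    have h := (((hasDerivAt_cos β).pow 2).const_mul a).add (((hasDerivAt_sin β).pow 2).const_mul c)
    refine (h.congr_deriv ?_).hasDerivWithinAt
    push_cast
    ring
  rw [← himg, lintegral_image_eq_lintegral_abs_deriv_mul measurableSet_Ioo hder hinj]
  refine setLIntegral_congr_fun measurableSet_Ioo fun β hβ => ?_
  have h1 := hsin β hβ
  have h2 := hcos β hβ
  have hca : 0 < c - a := by linarith
  have hsq : (c - a) * (c - f β) = ((c - a) * cos β) ^ 2 := by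
    rw [hfs]; linear_combination (-(c - a) ^ 2) * sin_sq_add_cos_sq β
  rw [← mul_assoc, ← ENNReal.ofReal_mul (abs_nonneg _), hsq, sqrt_sq (by positivity),
    abs_of_pos (by positivity)]
  congr 2
  field_simp

open Set Real in
/-- The substitution `φ = arctan (t tan θ)` with `t = √((b - k) / (c - k))`. -/
lemma lintegral_inv_sqrt_eq {a b c k : ℝ} (hak : a < k) (hkb : k < b) (hbc : b ≤ c) :
    ∫⁻ φ in Ioo (0 : ℝ) (π / 2), ENNReal.ofReal (1 / √((b * cos φ ^ 2 + c * sin φ ^ 2 - a) *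
        (b * cos φ ^ 2 + c * sin φ ^ 2 - k))) =
      ∫⁻ θ in Ioo (0 : ℝ) (π / 2), ENNReal.ofReal
        (1 / √((b - a) * (c - k) - (k - a) * (c - b) * sin θ ^ 2)) := by
  set t := √((b - k) / (c - k)) with ht
  have htpos : 0 < t := sqrt_pos.2 (div_pos (by linarith) (by linarith))
  have ht2 : t ^ 2 * (c - k) = b - k := by
    rw [ht, sq_sqrt (div_nonneg (by linarith) (by linarith))]
    exact div_mul_cancel₀ _ (by linarith)
  set f : ℝ → ℝ := fun θ => arctan (t * tan θ) with hf
  have hsin : ∀ β ∈ Ioo (0 : ℝ) (π / 2), 0 < sin β := fun β hβ =>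
    sin_pos_of_pos_of_lt_pi hβ.1 (by linarith [hβ.2, pi_pos])
  have hcos : ∀ β ∈ Ioo (0 : ℝ) (π / 2), 0 < cos β := fun β hβ =>
    cos_pos_of_mem_Ioo ⟨by linarith [hβ.1, pi_pos], hβ.2⟩
  have htan : ∀ β ∈ Ioo (0 : ℝ) (π / 2), 0 < tan β := fun β hβ =>
    tan_pos_of_pos_of_lt_pi_div_two hβ.1 hβ.2
  have himg : f '' Ioo 0 (π / 2) = Ioo 0 (π / 2) := by
    ext φ
    constructor
    · rintro ⟨θ, hθ, rfl⟩
      exact ⟨arctan_pos.2 (mul_pos htpos (htan θ hθ)), arctan_lt_pi_div_two _⟩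
    · intro hφ
      refine ⟨arctan (t⁻¹ * tan φ), ⟨arctan_pos.2 (mul_pos (inv_pos.2 htpos) (htan φ hφ)),
        arctan_lt_pi_div_two _⟩, ?_⟩
      simp only [hf]
      rw [tan_arctan, mul_inv_cancel_left₀ htpos.ne',
        arctan_tan (by linarith [hφ.1, pi_pos]) hφ.2]
  have hinj : InjOn f (Ioo 0 (π / 2)) := by
    intro x hx y hy hxy
    have h := mul_left_cancel₀ htpos.ne' (arctan_injective hxy)
    exact injOn_tan ⟨by linarith [hx.1, pi_pos], hx.2⟩ ⟨by linarith [hy.1, pi_pos], hy.2⟩ h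
  have hD : ∀ θ ∈ Ioo (0 : ℝ) (π / 2), 0 < cos θ ^ 2 + t ^ 2 * sin θ ^ 2 := fun θ hθ => by
    have := hcos θ hθ
    positivity
  have hder : ∀ θ ∈ Ioo (0 : ℝ) (π / 2),
      HasDerivWithinAt f (t / (cos θ ^ 2 + t ^ 2 * sin θ ^ 2)) (Ioo 0 (π / 2)) θ := by
    intro θ hθ
    have h := (((hasDerivAt_tan (hcos θ hθ).ne').const_mul t).arctan)
    refine (h.congr_deriv ?_).hasDerivWithinAt
    have h1 := (hcos θ hθ).ne'
    have h2 := (hD θ hθ).ne'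
    rw [tan_eq_sin_div_cos]
    field_simp
  conv_lhs => rw [← himg]
  rw [lintegral_image_eq_lintegral_abs_deriv_mul measurableSet_Ioo hder hinj]
  refine setLIntegral_congr_fun measurableSet_Ioo fun θ hθ => ?_
  have hc := hcos θ hθ
  have hDθ := hD θ hθ
  set D := cos θ ^ 2 + t ^ 2 * sin θ ^ 2 with hDdef
  have h1 : cos (f θ) ^ 2 = cos θ ^ 2 / D := by
    simp only [hf]
    rw [cos_sq_arctan, tan_eq_sin_div_cos]
    field_simp
    rw [hDdef]
  have h2 : sin (f θ) ^ 2 = t ^ 2 * sin θ ^ 2 / D := by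
    rw [sin_sq, h1, eq_div_iff hDθ.ne', sub_mul, div_mul_cancel₀ _ hDθ.ne', hDdef]
    ring
  have h3 : b * cos (f θ) ^ 2 + c * sin (f θ) ^ 2 - k = (b - k) / D := by
    rw [h1, h2]
    field_simp
    rw [hDdef]
    linear_combination sin θ ^ 2 * ht2 + (b - k) * sin_sq_add_cos_sq θ
  have hE : 0 < (b - a) * (c - k) - (k - a) * (c - b) * sin θ ^ 2 := by
    have e : (b - a) * (c - k) - (k - a) * (c - b) * sin θ ^ 2 =
        (b - a) * (c - k) * cos θ ^ 2 + (c - a) * (b - k) * sin θ ^ 2 := by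
      linear_combination (-(b - a) * (c - k)) * sin_sq_add_cos_sq θ
    rw [e]
    have h5 : 0 < (b - a) * (c - k) * cos θ ^ 2 :=
      mul_pos (mul_pos (by linarith) (by linarith)) (by positivity)
    have h6 : 0 ≤ (c - a) * (b - k) * sin θ ^ 2 :=
      mul_nonneg (mul_nonneg (by linarith) (by linarith)) (by positivity)
    linarith
  have h4 : (b * cos (f θ) ^ 2 + c * sin (f θ) ^ 2 - a) *
      (b * cos (f θ) ^ 2 + c * sin (f θ) ^ 2 - k) =
      (t / D) ^ 2 * ((b - a) * (c - k) - (k - a) * (c - b) * sin θ ^ 2) := by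
    have e1 : b * (cos θ ^ 2 / D) + c * (t ^ 2 * sin θ ^ 2 / D) - a =
        ((b - a) * cos θ ^ 2 + (c - a) * t ^ 2 * sin θ ^ 2) / D := by
      field_simp
      rw [hDdef]
      ring
    rw [h3, h1, h2, e1, div_mul_div_comm, div_pow, ← sq, div_mul_eq_mul_div]
    congr 1
    linear_combination (-(b - a) * cos θ ^ 2) * ht2 +
      t ^ 2 * (b - a) * (c - k) * sin_sq_add_cos_sq θ
  rw [h4, sqrt_mul (by positivity), sqrt_sq (by positivity), ← ENNReal.ofReal_mul (abs_nonneg _),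
    abs_of_pos (by positivity)]
  congr 1
  have h5 := (sqrt_pos.2 hE).ne'
  field_simp

open Set Real in
/-- The complete elliptic integral as an integral of nonnegative functions. -/
lemma ofReal_ellipticK_div {a b c k : ℝ} (hak : a < k) (hkb : k < b) (hbc : b ≤ c) :
    ENNReal.ofReal (ellipticK (((k - a) * (c - b)) / ((a - b) * (k - c))) / √((b - a) * (c - k))) =
      ∫⁻ θ in Ioo (0 : ℝ) (π / 2), ENNReal.ofReal
        (1 / √((b - a) * (c - k) - (k - a) * (c - b) * sin θ ^ 2)) := by
  have hP : 0 < (b - a) * (c - k) := mul_pos (by linarith) (by linarith)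
  set m := ((k - a) * (c - b)) / ((a - b) * (k - c)) with hm
  have hm' : (b - a) * (c - k) * m = (k - a) * (c - b) := by
    rw [hm, show (a - b) * (k - c) = (b - a) * (c - k) by ring]
    exact mul_div_cancel₀ _ hP.ne'
  have hm0 : 0 ≤ m := by
    rw [hm, show (a - b) * (k - c) = (b - a) * (c - k) by ring]
    exact div_nonneg (mul_nonneg (by linarith) (by linarith)) hP.le
  have hm1 : m < 1 := by
    by_contra! h
    nlinarith [mul_le_mul_of_nonneg_left h hP.le,
      mul_pos (show 0 < c - a by linarith) (show 0 < b - k by linarith)]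
  have hpos : ∀ θ, 0 < 1 - m * sin θ ^ 2 := by
    intro θ
    nlinarith [mul_le_mul_of_nonneg_left (sin_sq_le_one θ) hm0]
  have hcont : Continuous fun θ => 1 / √(1 - m * sin θ ^ 2) / √((b - a) * (c - k)) := by
    refine Continuous.div_const (continuous_const.div (by fun_prop) fun θ => ?_) _
    exact (sqrt_pos.2 (hpos θ)).ne'
  rw [ellipticK, ← intervalIntegral.integral_div, intervalIntegral.integral_of_le (by positivity),
    integral_Ioc_eq_integral_Ioo, ofReal_integral_eq_lintegral_ofReal]
  · refine lintegral_congr fun θ => ?_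
    congr 1
    rw [div_div, ← sqrt_mul (hpos θ).le]
    congr 2
    linear_combination (-sin θ ^ 2) * hm'
  · exact hcont.integrableOn_Icc.mono_set Ioo_subset_Icc_self
  · exact ae_of_all _ fun θ => by positivity

lemma measurable_ellipticK : Measurable ellipticK := by
  have h : Measurable fun p : ℝ × ℝ => 1 / √(1 - p.1 * Real.sin p.2 ^ 2) := by fun_prop
  have h2 : ellipticK = fun m => ∫ θ in Set.Ioc 0 (Real.pi / 2), 1 / √(1 - m * Real.sin θ ^ 2) := by
    funext m
    rw [ellipticK, intervalIntegral.integral_of_le (by positivity)]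
  rw [h2]
  exact h.stronglyMeasurable.integral_prod_right'.measurable

open Set Real in
/-- The integral of `G (a x² + b y² + c z²)` over an octant of the unit sphere, in spherical
coordinates with polar axis `x`. -/
noncomputable def octantIntegral (a b c : ℝ) (G : ℝ → ENNReal) : ENNReal :=
  ∫⁻ φ in Ioo (0 : ℝ) (π / 2), ∫⁻ β in Ioo (0 : ℝ) (π / 2), ENNReal.ofReal (sin β) *
    G (a * cos β ^ 2 + (b * cos φ ^ 2 + c * sin φ ^ 2) * sin β ^ 2)

/-- The density of the quadratic form `a x² + b y² + c z²` on an octant of the unit sphere, at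
values between `a` and `b`, with respect to the surface measure without normalization. -/
noncomputable def octantDensity (a b c k : ℝ) : ℝ :=
  1 / 2 * (ellipticK (((k - a) * (c - b)) / ((a - b) * (k - c))) / √((b - a) * (c - k)))

lemma octantDensity_neg (a b c k : ℝ) :
    octantDensity (-a) (-b) (-c) (-k) = octantDensity a b c k := by
  unfold octantDensity
  congr 3 <;> ring_nf

lemma octantIntegral_neg (a b c : ℝ) (G : ℝ → ENNReal) :
    octantIntegral (-a) (-b) (-c) (fun k => G (-k)) = octantIntegral a b c G := by
  unfold octantIntegral
  refine lintegral_congr fun φ => lintegral_congr fun β => ?_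
  congr 1
  exact congrArg G (by ring)

open Set Real in
/-- For fixed `φ` substitute `k` for `β`, exchange the integrals, and for fixed `k` recognize the
integral over `φ` as a complete elliptic integral. -/
lemma octantIntegral_of_lt {a b c : ℝ} (hab : a < b) (hbc : b ≤ c) {G : ℝ → ENNReal}
    (hG : Measurable G) (hG0 : ∀ k, b < k → G k = 0) :
    octantIntegral a b c G = ∫⁻ k in Ioo a b, ENNReal.ofReal (octantDensity a b c k) * G k := by
  have hC : ∀ φ, b ≤ b * cos φ ^ 2 + c * sin φ ^ 2 := fun φ => by
    have h : b * cos φ ^ 2 + c * sin φ ^ 2 = b + (c - b) * sin φ ^ 2 := by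
      linear_combination b * sin_sq_add_cos_sq φ
    rw [h]
    linarith [mul_nonneg (sub_nonneg.2 hbc) (sq_nonneg (sin φ))]
  have h1 : ∀ φ, ∫⁻ β in Ioo (0 : ℝ) (π / 2), ENNReal.ofReal (sin β) *
      G (a * cos β ^ 2 + (b * cos φ ^ 2 + c * sin φ ^ 2) * sin β ^ 2) =
      ∫⁻ k in Ioo a b, ENNReal.ofReal (1 / (2 * √((b * cos φ ^ 2 + c * sin φ ^ 2 - a) *
        (b * cos φ ^ 2 + c * sin φ ^ 2 - k)))) * G k := by
    intro φ
    rw [lintegral_sin_mul_comp_quadratic (hab.trans_le (hC φ))]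
    symm
    rw [← lintegral_indicator measurableSet_Ioo, ← lintegral_indicator measurableSet_Ioo]
    have hae : ∀ᵐ k ∂(volume : Measure ℝ), k ≠ b := Measure.ae_ne volume b
    refine lintegral_congr_ae ?_
    filter_upwards [hae] with k hk
    rcases lt_or_gt_of_ne hk with h | h
    · simp [indicator, h, h.trans_le (hC φ)]
    -- above `b` the function `G` vanishes, so the range `(a, C(φ))` may be cut down to `(a, b)`
    · rw [indicator_of_notMem (fun h' => h.not_gt h'.2)]
      simp [indicator, hG0 k h]
  rw [octantIntegral, lintegral_congr h1, lintegral_lintegral_swap]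
  · refine setLIntegral_congr_fun measurableSet_Ioo fun k hk => ?_
    rw [lintegral_mul_const _ (by fun_prop), octantDensity, ENNReal.ofReal_mul (by norm_num),
      ofReal_ellipticK_div hk.1 hk.2 hbc, ← lintegral_inv_sqrt_eq hk.1 hk.2 hbc,
      ← lintegral_const_mul' _ _ ENNReal.ofReal_ne_top]
    congr 1
    refine lintegral_congr fun φ => ?_
    rw [← ENNReal.ofReal_mul (by norm_num), div_mul_div_comm, one_mul]
  · exact Measurable.aemeasurable (Measurable.mul (by fun_prop) (hG.comp measurable_snd))

open Set in
lemma setLIntegral_octantDensity_neg (a b c : ℝ) (G : ℝ → ENNReal) :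
    ∫⁻ k in Ioo (-a) (-b), ENNReal.ofReal (octantDensity (-a) (-b) (-c) k) * G (-k) =
      ∫⁻ k in Ioo b a, ENNReal.ofReal (octantDensity a b c k) * G k := by
  have h := (Measure.measurePreserving_neg (volume : Measure ℝ)).setLIntegral_comp_preimage_emb
    (MeasurableEquiv.neg ℝ).measurableEmbedding
    (fun k => ENNReal.ofReal (octantDensity a b c k) * G k) (Ioo b a)
  have hpre : (Neg.neg : ℝ → ℝ) ⁻¹' Ioo b a = Ioo (-a) (-b) := by simp
  rw [hpre] at h
  rw [← h]
  refine lintegral_congr fun k => ?_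
  rw [← octantDensity_neg a b c, neg_neg]

open Set in
lemma octantIntegral_of_gt {a b c : ℝ} (hab : b < a) (hbc : c ≤ b) {G : ℝ → ENNReal}
    (hG : Measurable G) (hG0 : ∀ k, k < b → G k = 0) :
    octantIntegral a b c G = ∫⁻ k in Ioo b a, ENNReal.ofReal (octantDensity a b c k) * G k := by
  rw [← octantIntegral_neg, octantIntegral_of_lt (by linarith) (by linarith)
    (G := fun k => G (-k)) (hG.comp measurable_neg) (fun k hk => hG0 _ (by linarith)),
    setLIntegral_octantDensity_neg]

/-! ### Struve and Bessel functions -/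

open Real in
/-- Wallis's recurrence. -/
lemma integral_sin_pow_add_two (n : ℕ) : ∫ x in (0 : ℝ)..(π / 2), sin x ^ (n + 2) =
    (n + 1) / (n + 2) * ∫ x in (0 : ℝ)..(π / 2), sin x ^ n := by
  rw [integral_sin_pow]; simp

open Real Nat in
lemma integral_sin_pow_odd_eq_gamma (k : ℕ) :
    (∫ x in (0 : ℝ)..(π / 2), sin x ^ (2 * k + 1)) *
      (2 ^ (2 * k) * (Gamma (k + 3 / 2) * Gamma (k + 1 / 2))) = π / 2 * (2 * k)! := by
  induction k with
  | zero =>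
    have h : Gamma (3 / 2) = 1 / 2 * √π := by
      rw [show (3 / 2 : ℝ) = 1 / 2 + 1 by norm_num, Gamma_add_one (by norm_num), Gamma_one_half_eq]
    have h2 : √π * √π = π := mul_self_sqrt pi_pos.le
    simp only [Nat.cast_zero, zero_add, mul_zero, pow_zero, one_mul, pow_one, integral_sin,
      cos_zero, cos_pi_div_two, h, Gamma_one_half_eq, factorial_zero, Nat.cast_one]
    linear_combination 1 / 2 * h2
  | succ k ih =>
    have h1 : Gamma ((k : ℝ) + 1 + 3 / 2) = (k + 3 / 2) * Gamma (k + 3 / 2) := by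
      rw [← Gamma_add_one (by positivity)]; ring_nf
    have h2 : Gamma ((k : ℝ) + 1 + 1 / 2) = (k + 1 / 2) * Gamma (k + 1 / 2) := by
      rw [← Gamma_add_one (by positivity)]; ring_nf
    have h3 : ((2 * (k + 1))! : ℝ) = (2 * k + 2) * ((2 * k + 1) * (2 * k)!) := by
      rw [show 2 * (k + 1) = 2 * k + 1 + 1 by ring, factorial_succ, factorial_succ]
      push_cast; ring
    rw [show 2 * (k + 1) + 1 = (2 * k + 1) + 2 by ring, integral_sin_pow_add_two]
    push_cast
    rw [h1, h2, h3]
    have hq : (2 * (k : ℝ) + 1 + 1) / (2 * k + 1 + 2) * (2 * k + 3) = 2 * k + 2 := by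
      field_simp; ring
    linear_combination ((2 * (k : ℝ) + 2) * (2 * k + 1)) * ih +
      2 ^ (2 * k) * (∫ x in (0 : ℝ)..(π / 2), sin x ^ (2 * k + 1)) * Gamma (k + 3 / 2) *
        Gamma (k + 1 / 2) * (2 * k + 1) * hq

open Real Nat in
lemma integral_sin_pow_even_eq_factorial (k : ℕ) :
    (∫ x in (0 : ℝ)..(π / 2), sin x ^ (2 * k + 2)) *
      (2 ^ (2 * k + 1) * (k ! * (k + 1)!)) = π / 2 * (2 * k + 1)! := by
  induction k with
  | zero =>
    rw [integral_sin_pow_add_two]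
    simp
    ring
  | succ k ih =>
    have h3 : ((2 * (k + 1) + 1)! : ℝ) = (2 * k + 3) * ((2 * k + 2) * (2 * k + 1)!) := by
      rw [show 2 * (k + 1) + 1 = 2 * k + 1 + 1 + 1 by ring, factorial_succ (2 * k + 1 + 1),
        factorial_succ (2 * k + 1)]
      push_cast; ring
    rw [show 2 * (k + 1) + 2 = (2 * k + 2) + 2 by ring, integral_sin_pow_add_two, h3,
      factorial_succ (k + 1), factorial_succ k]
    rw [factorial_succ k] at ih
    push_cast at ih ⊢
    have hq : (2 * (k : ℝ) + 2 + 1) / (2 * k + 2 + 2) * (2 * k + 4) = 2 * k + 3 := by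
      field_simp; ring
    linear_combination ((2 * (k : ℝ) + 3) * (2 * k + 2)) * ih +
      (∫ x in (0 : ℝ)..(π / 2), sin x ^ (2 * k + 2)) * 2 ^ (2 * k + 1) * 2 * (k + 1) ^ 2 *
        (k ! : ℝ) ^ 2 * hq

open Real Nat in
/-- Expand the exponential: the even powers give the Struve series and the odd ones the Bessel
series. -/
lemma integral_sin_mul_exp_neg_mul_sin {z : ℝ} (hz : 0 ≤ z) :
    ∫ x in (0 : ℝ)..(π / 2), sin x * exp (-(z * sin x)) =
      π / 2 * (struveL (-1) z - besselI 1 z) := by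
  set f : ℕ → ℝ := fun n => (-z) ^ n / n ! * ∫ x in (0 : ℝ)..(π / 2), sin x ^ (n + 1) with hf
  have hsum : HasSum f (∫ x in (0 : ℝ)..(π / 2), sin x * exp (-(z * sin x))) := by
    have h := intervalIntegral.hasSum_integral_of_dominated_convergence (μ := volume) (a := 0)
      (b := π / 2) (F := fun (n : ℕ) x => (-z) ^ n / n ! * sin x ^ (n + 1))
      (f := fun x => sin x * exp (-(z * sin x))) (fun n _ => z ^ n / n !)
      (fun n => by exact Continuous.aestronglyMeasurable (by fun_prop)) ?_ ?_ ?_ ?_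
    · simpa only [hf, intervalIntegral.integral_const_mul] using h
    · refine fun n => ae_of_all _ fun x _ => ?_
      rw [norm_mul, norm_div, norm_pow, norm_neg, norm_pow, norm_of_nonneg hz]
      have h1 : ‖sin x‖ ^ (n + 1) ≤ 1 := pow_le_one₀ (norm_nonneg _) (abs_sin_le_one x)
      have h2 : ‖((n !: ℕ) : ℝ)‖ = n ! := by simp
      rw [h2]
      exact mul_le_of_le_one_right (by positivity) h1
    · exact ae_of_all _ fun x _ => summable_pow_div_factorial z
    · exact intervalIntegrable_const
    · refine ae_of_all _ fun x _ => ?_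
      have h := (NormedSpace.expSeries_div_hasSum_exp (-(z * sin x))).mul_left (sin x)
      rw [← exp_eq_exp_ℝ] at h
      refine h.congr_fun fun n => ?_
      rw [neg_mul_eq_neg_mul, mul_pow]
      ring
  have heven : Summable fun k => f (2 * k) :=
    hsum.summable.comp_injective (mul_right_injective₀ two_ne_zero)
  have hodd : Summable fun k => f (2 * k + 1) :=
    hsum.summable.comp_injective
      ((add_left_injective 1).comp (mul_right_injective₀ two_ne_zero))
  rw [← hsum.tsum_eq, ← tsum_even_add_odd heven hodd, mul_sub, struveL, besselI, ← tsum_mul_left,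
    ← tsum_mul_left, sub_eq_add_neg, ← tsum_neg]
  congr 1
  -- the terms of even degree
  · refine tsum_congr fun k => ?_
    have h := integral_sin_pow_odd_eq_gamma k
    have g1 : 0 < Gamma ((k : ℝ) + 3 / 2) := Gamma_pos_of_pos (by positivity)
    have g2 : 0 < Gamma ((k : ℝ) + 1 / 2) := Gamma_pos_of_pos (by positivity)
    rw [show (2 * (k : ℝ) + -1 + 1) = ((2 * k : ℕ) : ℝ) by push_cast; ring, rpow_natCast,
      show (k : ℝ) + -1 + 3 / 2 = k + 1 / 2 by ring, hf]
    simp only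
    rw [Even.neg_pow (even_two_mul k), div_pow]
    have h5 : ((2 * k)! : ℝ) ≠ 0 := by positivity
    generalize Gamma ((k : ℝ) + 3 / 2) = A at *
    generalize Gamma ((k : ℝ) + 1 / 2) = B at *
    field_simp
    linear_combination 2 * z ^ (2 * k) * h
  -- the terms of odd degree
  · refine tsum_congr fun k => ?_
    have h := integral_sin_pow_even_eq_factorial k
    rw [show (2 * (k : ℝ) + 1) = ((2 * k + 1 : ℕ) : ℝ) by push_cast; ring, rpow_natCast,
      show (k : ℝ) + 1 + 1 = ((k + 1 : ℕ) : ℝ) + 1 by push_cast; ring, Gamma_nat_eq_factorial, hf]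
    simp only
    rw [Odd.neg_pow (odd_two_mul_add_one k), div_pow]
    have h5 : ((2 * k + 1)! : ℝ) ≠ 0 := by positivity
    have h6 : ((k + 1)! : ℝ) ≠ 0 := by positivity
    field_simp
    linear_combination (-2) * z ^ (2 * k + 1) * h

/-! ### The law of the quadratic form and the average of the profile -/

open Set Real in
lemma lintegral_sin_sq : ∫⁻ α in Ioo (0 : ℝ) (π / 2), ENNReal.ofReal (sin α ^ 2) =
    ENNReal.ofReal (π / 4) := by
  rw [← ofReal_integral_eq_lintegral_ofReal]
  · rw [← integral_Ioc_eq_integral_Ioo, ← intervalIntegral.integral_of_le (by positivity),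
      integral_sin_sq]
    simp
    ring_nf
  · exact (Continuous.integrableOn_Icc (by fun_prop)).mono_set Ioo_subset_Icc_self
  · exact ae_of_all _ fun α => sq_nonneg _

open Set Real in
lemma octantIntegral_const (a b c : ℝ) (y : ENNReal) :
    octantIntegral a b c (fun _ => y) = ENNReal.ofReal (π / 2) * y := by
  have h : ∫⁻ β in Ioo (0 : ℝ) (π / 2), ENNReal.ofReal (sin β) = 1 := by
    rw [← ofReal_integral_eq_lintegral_ofReal]
    · rw [← integral_Ioc_eq_integral_Ioo, ← intervalIntegral.integral_of_le (by positivity),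
        integral_sin]
      simp
    · exact (Continuous.integrableOn_Icc (by fun_prop)).mono_set Ioo_subset_Icc_self
    · exact (ae_restrict_mem measurableSet_Ioo).mono fun β hβ =>
        (sin_pos_of_pos_of_lt_pi hβ.1 (by linarith [hβ.2, pi_pos])).le
  simp only [octantIntegral]
  rw [lintegral_mul_const _ (by fun_prop), h, one_mul, setLIntegral_const, Real.volume_Ioo,
    sub_zero, mul_comm]

lemma lintegral_quatBall_direction (a b c : ℝ) {G : ℝ → ENNReal} (hG : Measurable G) :
    ∫⁻ v, G ((a * v 1 ^ 2 + b * v 2 ^ 2 + c * v 3 ^ 2) / (v 1 ^ 2 + v 2 ^ 2 + v 3 ^ 2)) ∂quatBall =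
      ENNReal.ofReal Real.pi * octantIntegral a b c G := by
  rw [lintegral_quatBall_spherical a b c (Ψ := fun _ k => G k) (hG.comp measurable_snd)]
  simp only [octantIntegral]
  have h : ∀ y : ENNReal, ∫⁻ α in Set.Ioo (0 : ℝ) (Real.pi / 2),
      ENNReal.ofReal (Real.sin α ^ 2) * y = ENNReal.ofReal (Real.pi / 4) * y := fun y => by
    rw [lintegral_mul_const _ (by fun_prop), lintegral_sin_sq]
  simp only [h]
  have h2 : ∀ x y : ENNReal, x * (ENNReal.ofReal (Real.pi / 4) * y) =
      ENNReal.ofReal (Real.pi / 4) * (x * y) := fun x y => by ring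
  simp only [h2, lintegral_const_mul' (ENNReal.ofReal (Real.pi / 4)) _ ENNReal.ofReal_ne_top]
  rw [← mul_assoc]
  congr 1
  rw [← ENNReal.ofReal_ofNat 4, ← ENNReal.ofReal_mul (by positivity)]
  congr 1
  ring

lemma quatBall_univ : quatBall Set.univ = ENNReal.ofReal (Real.pi ^ 2 / 2) := by
  have h := lintegral_quatBall_direction 0 0 0 (G := fun _ => 1) measurable_const
  rw [lintegral_one, octantIntegral_const, mul_one, ← ENNReal.ofReal_mul Real.pi_pos.le] at h
  rw [h]
  congr 1
  ring

/-- The polar axis may be moved from the first to the third coordinate axis. -/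
lemma octantIntegral_swap (a b c : ℝ) {G : ℝ → ENNReal} (hG : Measurable G) :
    octantIntegral a b c G = octantIntegral c b a G := by
  have h := lintegral_quatBall_swap fun v =>
    G ((a * v 1 ^ 2 + b * v 2 ^ 2 + c * v 3 ^ 2) / (v 1 ^ 2 + v 2 ^ 2 + v 3 ^ 2))
  rw [lintegral_quatBall_direction a b c hG] at h
  have h2 : ∀ v : Fin 4 → ℝ, G ((a * (v ∘ Equiv.swap 1 3) 1 ^ 2 + b * (v ∘ Equiv.swap 1 3) 2 ^ 2 +
      c * (v ∘ Equiv.swap 1 3) 3 ^ 2) / ((v ∘ Equiv.swap 1 3) 1 ^ 2 + (v ∘ Equiv.swap 1 3) 2 ^ 2 +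
      (v ∘ Equiv.swap 1 3) 3 ^ 2)) =
      G ((c * v 1 ^ 2 + b * v 2 ^ 2 + a * v 3 ^ 2) / (v 1 ^ 2 + v 2 ^ 2 + v 3 ^ 2)) := by
    intro v
    simp only [Function.comp_apply, Equiv.swap_apply_left, Equiv.swap_apply_right]
    rw [Equiv.swap_apply_of_ne_of_ne (by decide) (by decide)]
    congr 1
    ring
  rw [lintegral_congr h2, lintegral_quatBall_direction c b a hG] at h
  exact ((ENNReal.mul_right_inj (by simp [Real.pi_pos]) ENNReal.ofReal_ne_top).1 h).symm

lemma octantIntegral_add (a b c : ℝ) {G H : ℝ → ENNReal} (hG : Measurable G) :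
    octantIntegral a b c (fun k => G k + H k) =
      octantIntegral a b c G + octantIntegral a b c H := by
  have hm : Measurable fun q : ℝ × ℝ => ENNReal.ofReal (Real.sin q.2) *
      G (a * Real.cos q.2 ^ 2 + (b * Real.cos q.1 ^ 2 + c * Real.sin q.1 ^ 2) *
        Real.sin q.2 ^ 2) := Measurable.mul (by fun_prop) (hG.comp (by fun_prop))
  simp only [octantIntegral, mul_add]
  rw [← lintegral_add_left hm.lintegral_prod_right']
  refine lintegral_congr fun φ => lintegral_add_left ?_ _
  exact hm.comp (f := fun β : ℝ => (φ, β)) (by fun_prop)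

open Set Real in
lemma octantIntegral_congr (a b c : ℝ) {G H : ℝ → ENNReal} (hGH : ∀ φ, ∀ β ∈ Ioo (0 : ℝ) (π / 2),
      G (a * cos β ^ 2 + (b * cos φ ^ 2 + c * sin φ ^ 2) * sin β ^ 2) =
        H (a * cos β ^ 2 + (b * cos φ ^ 2 + c * sin φ ^ 2) * sin β ^ 2)) :
    octantIntegral a b c G = octantIntegral a b c H :=
  lintegral_congr fun φ => setLIntegral_congr_fun measurableSet_Ioo fun β hβ => by
    rw [hGH φ β hβ]

open Set in
lemma octantIntegral_indicator_Iio {a b c : ℝ} (hab : a ≤ b) (hbc : b ≤ c) {G : ℝ → ENNReal}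
    (hG : Measurable G) : octantIntegral a b c ((Iio b).indicator G) =
      ∫⁻ k in Ioo a b, ENNReal.ofReal (octantDensity a b c k) * G k := by
  rcases hab.eq_or_lt with rfl | hab
  -- the form is bounded below by `a = b`, and the interval of integration is empty
  · have h : octantIntegral a a c ((Iio a).indicator G) = octantIntegral a a c (fun _ => 0) := by
      refine octantIntegral_congr _ _ _ fun φ β _ => indicator_of_notMem ?_ _
      have e : a * Real.cos β ^ 2 + (a * Real.cos φ ^ 2 + c * Real.sin φ ^ 2) * Real.sin β ^ 2 =
          a + (c - a) * Real.sin φ ^ 2 * Real.sin β ^ 2 := by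
        linear_combination a * Real.sin_sq_add_cos_sq β +
          a * Real.sin β ^ 2 * Real.sin_sq_add_cos_sq φ
      rw [e, mem_Iio, not_lt]
      have : 0 ≤ (c - a) * Real.sin φ ^ 2 * Real.sin β ^ 2 :=
        mul_nonneg (mul_nonneg (by linarith) (sq_nonneg _)) (sq_nonneg _)
      linarith
    rw [h, octantIntegral_const]
    simp
  · rw [octantIntegral_of_lt hab hbc (hG.indicator measurableSet_Iio)
      (fun k hk => indicator_of_notMem (by simpa using hk.le) _)]
    refine setLIntegral_congr_fun measurableSet_Ioo fun k hk => ?_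
    rw [indicator_of_mem (by exact hk.2)]

open Set in
lemma octantIntegral_indicator_Ioi {a b c : ℝ} (hab : b ≤ a) (hbc : c ≤ b) {G : ℝ → ENNReal}
    (hG : Measurable G) : octantIntegral a b c ((Ioi b).indicator G) =
      ∫⁻ k in Ioo b a, ENNReal.ofReal (octantDensity a b c k) * G k := by
  have h1 : octantIntegral a b c ((Ioi b).indicator G) =
      octantIntegral (-a) (-b) (-c) ((Iio (-b)).indicator fun k => G (-k)) := by
    rw [← octantIntegral_neg]
    congr 1
    funext k
    simp [indicator, lt_neg]
  rw [h1, octantIntegral_indicator_Iio (G := fun k => G (-k)) (by linarith) (by linarith)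
    (hG.comp measurable_neg), setLIntegral_octantDensity_neg]

open Set in
/-- The law of the quadratic form. Below the middle coefficient the polar axis is that of the
smallest coefficient, above it that of the largest one. -/
lemma octantIntegral_eq_add {a b c : ℝ} (hab : a ≤ b) (hbc : b ≤ c) (hne : ¬ (a = b ∧ b = c))
    {G : ℝ → ENNReal} (hG : Measurable G) : octantIntegral a b c G =
      (∫⁻ k in Ioo a b, ENNReal.ofReal (octantDensity a b c k) * G k) +
        ∫⁻ k in Ioo b c, ENNReal.ofReal (octantDensity c b a k) * G k := by
  have hsplit : G = fun k => (Iio b).indicator G k + ((Ioi b).indicator G k +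
      ({b} : Set ℝ).indicator G k) := by
    funext k
    rcases lt_trichotomy k b with h | h | h
    · simp [indicator, h, h.not_gt, h.ne]
    · simp [indicator, h]
    · simp [indicator, h, h.not_gt, h.ne']
  have h1 := hG.indicator (measurableSet_Iio (a := b))
  have h2 := hG.indicator (measurableSet_Ioi (a := b))
  have h3 := hG.indicator (measurableSet_singleton b)
  -- the law has no atom at `b`, since `b` differs from one of the extreme coefficients
  have hnull : octantIntegral a b c (({b} : Set ℝ).indicator G) = 0 := by
    rcases hab.eq_or_lt with rfl | hlt
    · have hlt : a < c := lt_of_le_of_ne hbc fun h => hne ⟨rfl, h⟩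
      rw [octantIntegral_swap _ _ _ h3, octantIntegral_of_gt hlt le_rfl h3
        (fun k hk => indicator_of_notMem (by simpa using hk.ne) _)]
      refine (setLIntegral_congr_fun measurableSet_Ioo fun k hk => ?_).trans lintegral_zero
      simp [indicator, hk.1.ne']
    · rw [octantIntegral_of_lt hlt hbc h3
        (fun k hk => indicator_of_notMem (by simpa using hk.ne') _)]
      refine (setLIntegral_congr_fun measurableSet_Ioo fun k hk => ?_).trans lintegral_zero
      simp [indicator, hk.2.ne]
  conv_lhs => rw [hsplit]
  rw [octantIntegral_add _ _ _ h1, octantIntegral_add _ _ _ h2, hnull, add_zero,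
    octantIntegral_indicator_Iio hab hbc hG, octantIntegral_swap _ _ _ h2,
    octantIntegral_indicator_Ioi hbc hab hG]

open Set Real in
/-- The integral of the Laplace profile over the angle `α` of a quaternion to the real axis, with
the weight `sin² α` of the surface measure of the sphere. -/
noncomputable def laplaceAverage (k : ℝ) : ENNReal :=
  ∫⁻ α in Ioo (0 : ℝ) (π / 2), ENNReal.ofReal (sin α ^ 2) *
    ENNReal.ofReal (laplaceProfile (sin α ^ 2 * k))

lemma measurable_laplaceAverage : Measurable laplaceAverage := by
  have h : Measurable fun q : ℝ × ℝ => ENNReal.ofReal (Real.sin q.2 ^ 2) *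
      ENNReal.ofReal (laplaceProfile (Real.sin q.2 ^ 2 * q.1)) :=
    Measurable.mul (by fun_prop) (measurable_laplaceProfile.comp (by fun_prop)).ennreal_ofReal
  exact h.lintegral_prod_right'

lemma lintegral_laplaceProfile (a b c : ℝ) :
    ∫⁻ v, ENNReal.ofReal (laplaceProfile
      ((a * v 1 ^ 2 + b * v 2 ^ 2 + c * v 3 ^ 2) / quatNormSq v)) ∂quatBall =
      4 * octantIntegral a b c laplaceAverage := by
  unfold octantIntegral laplaceAverage
  rw [← lintegral_quatBall_spherical a b c
    (Ψ := fun s k => ENNReal.ofReal (laplaceProfile (s * k)))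
    ((measurable_laplaceProfile.comp (by fun_prop)).ennreal_ofReal)]
  refine lintegral_congr fun v => ?_
  congr 2
  by_cases h : v 1 ^ 2 + v 2 ^ 2 + v 3 ^ 2 = 0
  · have h1 : v 1 ^ 2 = 0 := by nlinarith [sq_nonneg (v 1), sq_nonneg (v 2), sq_nonneg (v 3)]
    have h2 : v 2 ^ 2 = 0 := by nlinarith [sq_nonneg (v 1), sq_nonneg (v 2), sq_nonneg (v 3)]
    have h3 : v 3 ^ 2 = 0 := by nlinarith [sq_nonneg (v 1), sq_nonneg (v 2), sq_nonneg (v 3)]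
    rw [h1, h2, h3]
    simp
  · field_simp

open Real in
lemma sin_sq_mul_laplaceProfile {α k : ℝ} (hα : 0 < sin α) :
    sin α ^ 2 * laplaceProfile (sin α ^ 2 * k) = sin α * exp (-(√k * sin α)) / √k := by
  rw [laplaceProfile, sqrt_mul (sq_nonneg _), sqrt_sq hα.le, mul_comm (√k)]
  field_simp

open Set Real in
/-- For `k ≤ 0` both sides vanish, since division by zero yields zero. -/
lemma laplaceAverage_eq {k : ℝ} : laplaceAverage k =
    ENNReal.ofReal (π / 2 * (struveL (-1) √k - besselI 1 √k) / √k) := by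
  rw [← integral_sin_mul_exp_neg_mul_sin (sqrt_nonneg k), ← intervalIntegral.integral_div,
    intervalIntegral.integral_of_le (by positivity), integral_Ioc_eq_integral_Ioo,
    ofReal_integral_eq_lintegral_ofReal]
  · refine setLIntegral_congr_fun measurableSet_Ioo fun α hα => ?_
    have hs := sin_pos_of_pos_of_lt_pi hα.1 (by linarith [hα.2, pi_pos])
    rw [← ENNReal.ofReal_mul (sq_nonneg _), sin_sq_mul_laplaceProfile hs]
  · exact (Continuous.integrableOn_Icc (by fun_prop)).mono_set Ioo_subset_Icc_self
  · refine (ae_restrict_mem measurableSet_Ioo).mono fun α hα => ?_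
    have hs := sin_pos_of_pos_of_lt_pi hα.1 (by linarith [hα.2, pi_pos])
    simp only [Pi.zero_apply]
    positivity

open Set Real in
/-- The integral over `α` is `O(1 / √k)`, and `k ≥ b sin² β`, so the weight `sin β` makes the
integrand bounded. -/
lemma octantIntegral_laplaceAverage_ne_top {a b c : ℝ} (ha : 0 ≤ a) (hb : 0 < b) (hbc : b ≤ c) :
    octantIntegral a b c laplaceAverage ≠ ⊤ := by
  have havg : ∀ k, laplaceAverage k ≤ ENNReal.ofReal (1 / √k) * ENNReal.ofReal (π / 2) := by
    intro k
    calc laplaceAverage k ≤ ∫⁻ α in Ioo (0 : ℝ) (π / 2), ENNReal.ofReal (1 / √k) := by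
          refine setLIntegral_mono measurable_const fun α hα => ?_
          have hs := sin_pos_of_pos_of_lt_pi hα.1 (by linarith [hα.2, pi_pos])
          rw [← ENNReal.ofReal_mul (sq_nonneg _), sin_sq_mul_laplaceProfile hs]
          refine ENNReal.ofReal_le_ofReal (div_le_div_of_nonneg_right ?_ (sqrt_nonneg _))
          have h1 : exp (-(√k * sin α)) ≤ 1 := exp_le_one_iff.2 (by
            have := mul_nonneg (sqrt_nonneg k) hs.le
            linarith)
          exact mul_le_one₀ (sin_le_one α) (exp_pos _).le h1
      _ = _ := by rw [setLIntegral_const, Real.volume_Ioo, sub_zero]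
  have hle : octantIntegral a b c laplaceAverage ≤ ∫⁻ φ in Ioo (0 : ℝ) (π / 2),
      ∫⁻ β in Ioo (0 : ℝ) (π / 2), ENNReal.ofReal (1 / √b) * ENNReal.ofReal (π / 2) := by
    refine lintegral_mono fun φ => setLIntegral_mono measurable_const fun β hβ => ?_
    have hs := sin_pos_of_pos_of_lt_pi hβ.1 (by linarith [hβ.2, pi_pos])
    refine (mul_le_mul_right (havg _) _).trans ?_
    rw [← mul_assoc, ← ENNReal.ofReal_mul hs.le]
    refine mul_le_mul_left (ENNReal.ofReal_le_ofReal ?_) _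
    have hk : b * sin β ^ 2 ≤ a * cos β ^ 2 + (b * cos φ ^ 2 + c * sin φ ^ 2) * sin β ^ 2 := by
      have e : a * cos β ^ 2 + (b * cos φ ^ 2 + c * sin φ ^ 2) * sin β ^ 2 =
          b * sin β ^ 2 + (a * cos β ^ 2 + (c - b) * sin φ ^ 2 * sin β ^ 2) := by
        linear_combination b * sin β ^ 2 * sin_sq_add_cos_sq φ
      have h1 : 0 ≤ (c - b) * sin φ ^ 2 * sin β ^ 2 :=
        mul_nonneg (mul_nonneg (by linarith) (sq_nonneg _)) (sq_nonneg _)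
      have h2 : 0 ≤ a * cos β ^ 2 := by positivity
      linarith
    have hk2 : √b * sin β ≤
        √(a * cos β ^ 2 + (b * cos φ ^ 2 + c * sin φ ^ 2) * sin β ^ 2) := by
      rw [← sqrt_sq hs.le, ← sqrt_mul hb.le]
      exact sqrt_le_sqrt (by rw [sqrt_sq hs.le]; exact hk)
    have hb' := sqrt_pos.2 hb
    rw [mul_one_div, div_le_div_iff₀ (lt_of_lt_of_le (by positivity) hk2) hb']
    linarith
  refine ne_top_of_le_ne_top ?_ hle
  simp only [setLIntegral_const, Real.volume_Ioo]
  exact ENNReal.mul_ne_top (ENNReal.mul_ne_top (ENNReal.mul_ne_top ENNReal.ofReal_ne_top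
    ENNReal.ofReal_ne_top) ENNReal.ofReal_ne_top) ENNReal.ofReal_ne_top

/-! ### The normalization factor -/

open Real in
lemma struveL_sub_besselI_nonneg {z : ℝ} (hz : 0 ≤ z) : 0 ≤ struveL (-1) z - besselI 1 z := by
  have h : 0 ≤ π / 2 * (struveL (-1) z - besselI 1 z) := by
    rw [← integral_sin_mul_exp_neg_mul_sin hz]
    refine intervalIntegral.integral_nonneg (by positivity) fun x hx => ?_
    have := sin_nonneg_of_nonneg_of_le_pi hx.1 (by linarith [hx.2, pi_pos])
    positivity
  exact nonneg_of_mul_nonneg_right h (by positivity)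

lemma ellipticK_nonneg (m : ℝ) : 0 ≤ ellipticK m :=
  intervalIntegral.integral_nonneg (by positivity) fun _ _ => by positivity

open Real in
lemma measurable_struveL_sub_besselI_sqrt :
    Measurable fun k : ℝ => struveL (-1) √k - besselI 1 √k := by
  have h : Measurable fun p : ℝ × ℝ => sin p.2 * exp (-(√p.1 * sin p.2)) := by fun_prop
  have h2 : (fun k : ℝ => struveL (-1) √k - besselI 1 √k) = fun k => 2 / π *
      ∫ x in Set.Ioc 0 (π / 2), sin x * exp (-(√k * sin x)) := by
    funext k
    rw [← intervalIntegral.integral_of_le (by positivity),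
      integral_sin_mul_exp_neg_mul_sin (sqrt_nonneg k)]
    field_simp
  rw [h2]
  exact h.stronglyMeasurable.integral_prod_right'.measurable.const_mul _

lemma measurable_lowerIntegrand (a b c : ℝ) : Measurable (lowerIntegrand a b c) := by
  unfold lowerIntegrand
  exact (measurable_struveL_sub_besselI_sqrt.mul
    (measurable_ellipticK.comp (by fun_prop))).div (by fun_prop)

lemma lowerIntegrand_nonneg (a b c k : ℝ) : 0 ≤ lowerIntegrand a b c k :=
  div_nonneg (mul_nonneg (struveL_sub_besselI_nonneg (Real.sqrt_nonneg k)) (ellipticK_nonneg _))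
    (Real.sqrt_nonneg _)

/-- Both integrands are the same function, with the extreme coefficients exchanged. -/
lemma upperIntegrand_eq (a b c : ℝ) : upperIntegrand a b c = lowerIntegrand c b a := rfl

lemma octantDensity_mul_laplaceAverage {a b c k : ℝ} (hk : 0 < k) :
    ENNReal.ofReal (octantDensity a b c k) * laplaceAverage k =
      ENNReal.ofReal (Real.pi / 4) * ENNReal.ofReal (lowerIntegrand a b c k) := by
  have h0 : 0 ≤ octantDensity a b c k := by
    have := ellipticK_nonneg (((k - a) * (c - b)) / ((a - b) * (k - c)))
    unfold octantDensity
    positivity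
  rw [laplaceAverage_eq, ← ENNReal.ofReal_mul h0, ← ENNReal.ofReal_mul (by positivity)]
  congr 1
  rw [octantDensity, lowerIntegrand, mul_assoc k, Real.sqrt_mul hk.le]
  ring

open Set in
lemma lintegral_octantDensity {a b c d e : ℝ} (hd : 0 ≤ d) :
    ∫⁻ k in Ioo d e, ENNReal.ofReal (octantDensity a b c k) * laplaceAverage k =
      ENNReal.ofReal (Real.pi / 4) * ∫⁻ k in Ioo d e, ENNReal.ofReal (lowerIntegrand a b c k) := by
  rw [← lintegral_const_mul' _ _ ENNReal.ofReal_ne_top]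
  exact setLIntegral_congr_fun measurableSet_Ioo fun k hk =>
    octantDensity_mul_laplaceAverage (hd.trans_lt hk.1)

lemma intervalIntegrable_lowerIntegrand {a b c d e : ℝ} (hde : d ≤ e)
    (h : ∫⁻ k in Set.Ioo d e, ENNReal.ofReal (lowerIntegrand a b c k) ≠ ⊤) :
    IntervalIntegrable (lowerIntegrand a b c) volume d e := by
  rw [intervalIntegrable_iff_integrableOn_Ioo_of_le hde]
  exact (lintegral_ofReal_ne_top_iff_integrable
    (measurable_lowerIntegrand a b c).aestronglyMeasurable
    (ae_of_all _ (lowerIntegrand_nonneg a b c))).1 h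

lemma ofReal_integral_lowerIntegrand {a b c d e : ℝ} (hde : d ≤ e)
    (h : IntervalIntegrable (lowerIntegrand a b c) volume d e) :
    ENNReal.ofReal (∫ k in d..e, lowerIntegrand a b c k) =
      ∫⁻ k in Set.Ioo d e, ENNReal.ofReal (lowerIntegrand a b c k) := by
  rw [intervalIntegral.integral_of_le hde, integral_Ioc_eq_integral_Ioo]
  exact ofReal_integral_eq_lintegral_ofReal
    ((intervalIntegrable_iff_integrableOn_Ioo_of_le hde).1 h)
    (ae_of_all _ (lowerIntegrand_nonneg a b c))

lemma unnormalizedDensity_nonneg (A : Matrix (Fin 3) (Fin 3) ℝ) (R : SO3) :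
    0 ≤ unnormalizedDensity A R := laplaceProfile_nonneg _

/-- The normalization factor as an integral over an octant of the sphere. -/
lemma lintegral_unnormalizedDensity_eq_octantIntegral (A : Matrix (Fin 3) (Fin 3) ℝ) :
    ∫⁻ R, ENNReal.ofReal (unnormalizedDensity A R) ∂haarSO3 = ENNReal.ofReal (8 / Real.pi ^ 2) *
      octantIntegral (2 * (properSingularValue A 1 + properSingularValue A 2))
        (2 * (properSingularValue A 0 + properSingularValue A 2))
        (2 * (properSingularValue A 0 + properSingularValue A 1)) laplaceAverage := by
  have h := lintegral_unnormalizedDensity A (by rw [quatBall_univ]; exact ENNReal.ofReal_ne_top)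
  have hpi := Real.pi_pos
  rw [lintegral_laplaceProfile, quatBall_univ] at h
  rw [show 8 / Real.pi ^ 2 = (2 / Real.pi ^ 2) * 4 by ring, ENNReal.ofReal_mul (by positivity),
    ENNReal.ofReal_ofNat, mul_assoc, ← h, ← mul_assoc, ← ENNReal.ofReal_mul (by positivity)]
  rw [show 2 / Real.pi ^ 2 * (Real.pi ^ 2 / 2) = 1 by field_simp]
  simp

end RotationLaplace

theorem mainTheorem3 (A : Matrix (Fin 3) (Fin 3) ℝ) (s₁ s₂ s₃ t₁ t₂ t₃ : ℝ)
    (hs₁ : s₁ = RotationLaplace.properSingularValue A 0)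
    (hs₂ : s₂ = RotationLaplace.properSingularValue A 1)
    (hs₃ : s₃ = RotationLaplace.properSingularValue A 2)
    (ht₁ : t₁ = 2 * (s₂ + s₃)) (ht₂ : t₂ = 2 * (s₁ + s₃)) (ht₃ : t₃ = 2 * (s₁ + s₂))
    (hpos : 0 < t₂) :
    MeasureTheory.Integrable (RotationLaplace.unnormalizedDensity A) RotationLaplace.haarSO3 ∧
    (¬ (s₁ = s₂ ∧ s₂ = s₃) →
      IntervalIntegrable (RotationLaplace.lowerIntegrand t₁ t₂ t₃) MeasureTheory.volume t₁ t₂ ∧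
      IntervalIntegrable (RotationLaplace.upperIntegrand t₁ t₂ t₃) MeasureTheory.volume t₂ t₃ ∧
      RotationLaplace.normalizationFactor A =
        2 / Real.pi * ((∫ k in t₁..t₂, RotationLaplace.lowerIntegrand t₁ t₂ t₃ k) +
          ∫ k in t₂..t₃, RotationLaplace.upperIntegrand t₁ t₂ t₃ k)) ∧
    (∀ s : ℝ, s₁ = s → s₂ = s → s₃ = s →
      RotationLaplace.normalizationFactor A =
        (RotationLaplace.struveL (-1) (2 * √s) - RotationLaplace.besselI 1 (2 * √s)) / √s) := by
  open RotationLaplace in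
  obtain ⟨⟨h21, h32⟩, -⟩ := exists_properSVD A
  rw [← hs₁, ← hs₂] at h21
  rw [← hs₂, ← hs₃] at h32
  obtain ⟨h32l, h32r⟩ := abs_le.1 h32
  have h1 : 0 ≤ t₁ := by linarith
  have h12 : t₁ ≤ t₂ := by linarith
  have h23 : t₂ ≤ t₃ := by linarith
  have hpi := Real.pi_pos
  have hE := lintegral_unnormalizedDensity_eq_octantIntegral A
  rw [← hs₁, ← hs₂, ← hs₃, ← ht₁, ← ht₂, ← ht₃] at hE
  have hfin := octantIntegral_laplaceAverage_ne_top h1 hpos h23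
  have hint : Integrable (unnormalizedDensity A) haarSO3 := by
    refine (lintegral_ofReal_ne_top_iff_integrable
      (measurable_unnormalizedDensity A).aestronglyMeasurable
      (ae_of_all _ (unnormalizedDensity_nonneg A))).1 ?_
    rw [hE]
    exact ENNReal.mul_ne_top ENNReal.ofReal_ne_top hfin
  have hF : ENNReal.ofReal (normalizationFactor A) = ENNReal.ofReal (8 / Real.pi ^ 2) *
      octantIntegral t₁ t₂ t₃ laplaceAverage := by
    rw [← hE]
    exact ofReal_integral_eq_lintegral_ofReal hint (ae_of_all _ (unnormalizedDensity_nonneg A))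
  have hF0 : 0 ≤ normalizationFactor A := integral_nonneg (unnormalizedDensity_nonneg A)
  refine ⟨hint, fun hne => ?_, fun s e1 e2 e3 => ?_⟩
  · have hne' : ¬ (t₁ = t₂ ∧ t₂ = t₃) := fun h => hne ⟨by linarith [h.1], by linarith [h.2]⟩
    have hsum := octantIntegral_eq_add h12 h23 hne' measurable_laplaceAverage
    rw [lintegral_octantDensity h1, lintegral_octantDensity hpos.le, ← mul_add] at hsum
    have hpi4 : ENNReal.ofReal (Real.pi / 4) ≠ 0 := by simp [hpi]
    have hfin' : (∫⁻ k in Set.Ioo t₁ t₂, ENNReal.ofReal (lowerIntegrand t₁ t₂ t₃ k)) +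
        ∫⁻ k in Set.Ioo t₂ t₃, ENNReal.ofReal (lowerIntegrand t₃ t₂ t₁ k) ≠ ⊤ := by
      intro h
      rw [hsum, h, ENNReal.mul_top hpi4] at hfin
      exact hfin rfl
    have hl := intervalIntegrable_lowerIntegrand h12 (ENNReal.add_ne_top.1 hfin').1
    have hu := intervalIntegrable_lowerIntegrand h23 (ENNReal.add_ne_top.1 hfin').2
    rw [upperIntegrand_eq]
    refine ⟨hl, hu, ?_⟩
    have n1 := intervalIntegral.integral_nonneg (μ := volume) h12
      fun k _ => lowerIntegrand_nonneg t₁ t₂ t₃ k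
    have n2 := intervalIntegral.integral_nonneg (μ := volume) h23
      fun k _ => lowerIntegrand_nonneg t₃ t₂ t₁ k
    rw [hsum, ← ofReal_integral_lowerIntegrand h12 hl, ← ofReal_integral_lowerIntegrand h23 hu,
      ← ENNReal.ofReal_add n1 n2, ← mul_assoc, ← ENNReal.ofReal_mul (by positivity),
      ← ENNReal.ofReal_mul (by positivity),
      ENNReal.ofReal_eq_ofReal_iff hF0 (mul_nonneg (by positivity) (add_nonneg n1 n2))] at hF
    rw [hF]
    congr 1
    field_simp
    norm_num
  -- all coefficients equal `4 s`, so the quadratic form is constant on the sphere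
  · subst e1
    have hs : 0 < s₁ := by linarith
    have a1 : t₁ = 4 * s₁ := by linarith
    have a2 : t₂ = 4 * s₁ := by linarith
    have a3 : t₃ = 4 * s₁ := by linarith
    have hc : octantIntegral t₁ t₂ t₃ laplaceAverage =
        octantIntegral t₁ t₂ t₃ (fun _ => laplaceAverage (4 * s₁)) := by
      refine octantIntegral_congr _ _ _ fun φ β _ => congrArg _ ?_
      rw [a1, a2, a3]
      linear_combination (4 * s₁) * Real.sin_sq_add_cos_sq β +
        4 * s₁ * Real.sin β ^ 2 * Real.sin_sq_add_cos_sq φ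
    have hsqrt : √(4 * s₁) = 2 * √s₁ := by
      rw [Real.sqrt_mul (by norm_num), show (4 : ℝ) = 2 ^ 2 by norm_num,
        Real.sqrt_sq (by norm_num)]
    have hLI := struveL_sub_besselI_nonneg (z := 2 * √s₁) (by positivity)
    have hs' := Real.sqrt_pos.2 hs
    rw [hc, octantIntegral_const, laplaceAverage_eq, hsqrt, ← ENNReal.ofReal_mul (by positivity),
      ← ENNReal.ofReal_mul (by positivity),
      ENNReal.ofReal_eq_ofReal_iff hF0 (by positivity)] at hF
    rw [hF]
    field_simp
    norm_num
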